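/- Let $L\ge 1$ and let $\Lambda$ be the hexagonal lattice with periodic boundary conditions whose sites are the $2L^2$ triangular faces of an $L\times L$ parallelogram of the triangular lattice (sides along two lattice directions, opposite sides identified), two sites being nearest neighbours if the faces share an edge. For $\sigma\in\mathcal X=\{-1,+1\}^\Lambda$ let $$H(\sigma)=-\frac J2\sum_{\{i,j\}}\sigma(i)\sigma(j)-\frac h2\sum_{i\in\Lambda}\sigma(i),$$ where the first sum runs over the unordered pairs of nearest neighbours. Assume $0<h<1$, $J\ge 2h$, $\frac{J}{2h}-\frac12\notin\mathbb Z$ and $|\Lambda|\ge(4J/h)^2$. For each inverse temperature $\beta$ let $(X_t)_{t\in\mathbb N}$ be the Metropolis Markov chain on $\mathcal X$: for $\eta\ne\sigma$, $P(\sigma,\eta)=\frac1{|\Lambda|}e^{-\beta\max(H(\eta)-H(\sigma),0)}$ if $\eta$ is obtained from $\sigma$ by flipping one spin, $P(\sigma,\eta)=0$ otherwise, and $P(\sigma,\sigma)=1-\sum_{\eta\neq\sigma}P(\sigma,\eta)$. Let $\mathbb P_\sigma$ be the law of the chain started at $\sigma$, and $\tau_A=\inf\{t>0: X_t\in A\}$.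 For $\sigma,\eta\in\mathcal X$ let $\Phi(\sigma,\eta)$ be the minimum, over all finite paths of single spin flips from $\sigma$ to $\eta$, of the maximum of $H$ along the path. Let $\mathcal I_\sigma=\{\eta: H(\eta)<H(\sigma)\}$, let $V_\sigma=\min_{\eta\in\mathcal I_\sigma}\Phi(\sigma,\eta)-H(\sigma)$ be the stability level of $\sigma$ ($V_\sigma=\infty$ if $\mathcal I_\sigma=\emptyset$), and for $V\in\mathbb R$ let $\mathcal X_V=\{\sigma: V_\sigma>V\}$. Set $V^*=2J$. Then $\mathcal X_{V^*}=\{\underline{-1},\underline{+1}\}$, the set of the two constant configurations, and for every $\epsilon>0$ the function $$f(\beta)=\sup_{\sigma\in\mathcal X}\mathbb P_\sigma\bigl(\tau_{\mathcal X_{V^*}}>e^{\beta(V^*+\epsilon)}\bigr)$$ is super-exponentially small, i.e. $\lim_{\beta\to\infty}\frac{\log f(\beta)}{\beta}=-\infty$. -/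

import Mathlib

open scoped ENNReal NNReal

namespace HexIsing

noncomputable section

/-! ### The hexagonal lattice on the torus -/

/-- The sites of the `L × L` torus: the faces of the triangular lattice with vertex set
`(ZMod L)²` (basis `e₁, e₂` at angle `π / 3`).  `inl (a, b)` is the upward triangle with vertices
`(a, b), (a+1, b), (a, b+1)`, and `inr (a, b)` is the downward triangle with vertices
`(a+1, b), (a, b+1), (a+1, b+1)`. -/
abbrev Site (L : ℕ) : Type := (ZMod L × ZMod L) ⊕ (ZMod L × ZMod L)

/-- The upward triangle `u` and the downward triangle `d` share an edge. -/
def Touches {L : ℕ} (u d : ZMod L × ZMod L) : Prop :=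
  d = u ∨ d = (u.1 - 1, u.2) ∨ d = (u.1, u.2 - 1)

instance {L : ℕ} (u d : ZMod L × ZMod L) : Decidable (Touches u d) := by
  unfold Touches; infer_instance

/-- The adjacency relation of the hexagonal lattice: two faces share an edge. -/
def SiteAdj {L : ℕ} : Site L → Site L → Prop
  | .inl u, .inr d => Touches u d
  | .inr d, .inl u => Touches u d
  | _, _ => False

instance {L : ℕ} : DecidableRel (SiteAdj (L := L)) := fun x y => by
  rcases x with x | x <;> rcases y with y | y <;> unfold SiteAdj <;> infer_instance

/-- The hexagonal lattice with periodic boundary conditions, as a graph on its sites. -/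
def hexTorus (L : ℕ) : SimpleGraph (Site L) where
  Adj := SiteAdj
  symm := ⟨fun x y => by rcases x with x | x <;> rcases y with y | y <;> exact id⟩
  loopless := ⟨fun x => by rcases x with x | x <;> exact id⟩

instance (L : ℕ) : DecidableRel (hexTorus L).Adj :=
  inferInstanceAs (DecidableRel (SiteAdj (L := L)))

/-! ### Configurations and energy -/

/-- Spin configurations; `ℤˣ = {1, -1}`. -/
abbrev Config (L : ℕ) : Type := Site L → ℤˣ

/-- The configuration with all spins equal to `+1`. -/
def allPlus (L : ℕ) : Config L := fun _ => 1

/-- The configuration with all spins equal to `-1`. -/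
def allMinus (L : ℕ) : Config L := fun _ => -1

/-- The real value `±1` of the spin at the site `i`. -/
def spin {L : ℕ} (σ : Config L) (i : Site L) : ℝ := ((σ i : ℤ) : ℝ)

/-- The product of the two spins at the ends of a bond. -/
def bondSpin {L : ℕ} (σ : Config L) : Sym2 (Site L) → ℝ :=
  Sym2.lift ⟨fun i j => spin σ i * spin σ j, fun _ _ => mul_comm _ _⟩

/-- The Hamiltonian; every nearest-neighbour bond is counted once. -/
def energy {L : ℕ} [NeZero L] (J h : ℝ) (σ : Config L) : ℝ :=
  -(J / 2) * ∑ e ∈ (hexTorus L).edgeFinset, bondSpin σ e - h / 2 * ∑ i, spin σ i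

/-- The configuration `σ` with the spin at `x` flipped. -/
def spinFlip {L : ℕ} (σ : Config L) (x : Site L) : Config L := Function.update σ x (-σ x)

theorem spinFlip_ne {L : ℕ} (σ : Config L) (x : Site L) : spinFlip σ x ≠ σ := by
  intro hx
  have h1 : spinFlip σ x x = σ x := by rw [hx]
  simp only [spinFlip, Function.update_self] at h1
  rcases Int.units_eq_one_or (σ x) with h2 | h2 <;> rw [h2] at h1 <;> revert h1 <;> decide

theorem spinFlip_spinFlip {L : ℕ} (σ : Config L) (x : Site L) : spinFlip (spinFlip σ x) x = σ := by
  simp [spinFlip]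

/-! ### Paths, communication height and stability level -/

/-- Two configurations are adjacent if they differ by a single spin flip. -/
def flipGraph (L : ℕ) : SimpleGraph (Config L) where
  Adj σ η := ∃ x, spinFlip σ x = η
  symm := ⟨by rintro σ _ ⟨x, rfl⟩; exact ⟨x, spinFlip_spinFlip σ x⟩⟩
  loopless := ⟨by rintro σ ⟨x, hx⟩; exact spinFlip_ne σ x hx⟩

/-- The maximal energy along a path of single spin flips. -/
def pathHeight {L : ℕ} [NeZero L] (J h : ℝ) {σ η : Config L} (ω : (flipGraph L).Walk σ η) :
    EReal :=
  ⨆ ζ ∈ ω.support, (energy J h ζ : EReal)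

/-- The communication height between two configurations. -/
def commHeight {L : ℕ} [NeZero L] (J h : ℝ) (σ η : Config L) : EReal :=
  ⨅ ω : (flipGraph L).Walk σ η, pathHeight J h ω

/-- The communication height between two sets of configurations (`⊤` if one of them is empty). -/
def commHeightSet {L : ℕ} [NeZero L] (J h : ℝ) (A B : Set (Config L)) : EReal :=
  ⨅ σ ∈ A, ⨅ η ∈ B, commHeight J h σ η

/-- The configurations of energy strictly lower than that of `σ`. -/
def lowerConfigs {L : ℕ} [NeZero L] (J h : ℝ) (σ : Config L) : Set (Config L) :=
  {η | energy J h η < energy J h σ}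

/-- The stability level of `σ`; it is `⊤` if no configuration has lower energy. -/
def stabLevel {L : ℕ} [NeZero L] (J h : ℝ) (σ : Config L) : EReal :=
  commHeightSet J h {σ} (lowerConfigs J h σ) - (energy J h σ : EReal)

/-- The configurations with stability level strictly greater than `V`. -/
def stableSet (L : ℕ) [NeZero L] (J h V : ℝ) : Set (Config L) :=
  {σ | (V : EReal) < stabLevel J h σ}

/-! ### The Metropolis dynamics -/

/-- The connectivity matrix (used off the diagonal only). -/
def connectivity {L : ℕ} [NeZero L] (σ η : Config L) : ℝ :=
  if ∃ x, spinFlip σ x = η then 1 / (Fintype.card (Site L) : ℝ) else 0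

/-- The Metropolis rate `q(σ, η) exp (-β [H(η) - H(σ)]₊)`. -/
def rate {L : ℕ} [NeZero L] (J h : ℝ) (β : ℝ≥0) (σ η : Config L) : ℝ :=
  connectivity σ η * Real.exp (-(β * max (energy J h η - energy J h σ) 0))

/-- The transition probabilities at inverse temperature `β`. -/
def transProb {L : ℕ} [NeZero L] (J h : ℝ) (β : ℝ≥0) (σ η : Config L) : ℝ :=
  if σ = η then 1 - ∑ ζ ∈ Finset.univ.erase σ, rate J h β σ ζ else rate J h β σ η

theorem connectivity_nonneg {L : ℕ} [NeZero L] (σ η : Config L) : 0 ≤ connectivity σ η := by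
  unfold connectivity; split_ifs <;> positivity

theorem rate_nonneg {L : ℕ} [NeZero L] (J h : ℝ) (β : ℝ≥0) (σ η : Config L) :
    0 ≤ rate J h β σ η :=
  mul_nonneg (connectivity_nonneg σ η) (Real.exp_pos _).le

theorem sum_connectivity_le {L : ℕ} [NeZero L] (σ : Config L) :
    ∑ η, connectivity σ η ≤ 1 := by
  classical
  have hc : (0 : ℝ) < (Fintype.card (Site L) : ℝ) := by exact_mod_cast Fintype.card_pos
  have h1 : (Finset.univ.filter fun η : Config L => ∃ x, spinFlip σ x = η)
      = Finset.univ.image (spinFlip σ) := by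
    ext η; simp
  have h2 : (Finset.univ.image (spinFlip σ)).card ≤ Fintype.card (Site L) := Finset.card_image_le
  have h3 : ((Finset.univ.image (spinFlip σ)).card : ℝ) ≤ Fintype.card (Site L) := by
    exact_mod_cast h2
  simp only [connectivity]
  rw [← Finset.sum_filter, h1, Finset.sum_const, nsmul_eq_mul, mul_one_div]
  exact (div_le_one hc).2 h3

theorem sum_rate_le {L : ℕ} [NeZero L] (J h : ℝ) (β : ℝ≥0) (σ : Config L) :
    ∑ ζ ∈ Finset.univ.erase σ, rate J h β σ ζ ≤ 1 := by
  refine le_trans ?_ (sum_connectivity_le σ)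
  refine le_trans (Finset.sum_le_sum_of_subset_of_nonneg (Finset.erase_subset _ _)
    fun _ _ _ => rate_nonneg J h β σ _) ?_
  refine Finset.sum_le_sum fun η _ => mul_le_of_le_one_right (connectivity_nonneg σ η) ?_
  exact Real.exp_le_one_iff.2 (neg_nonpos.2 (mul_nonneg β.2 (le_max_right _ _)))

theorem transProb_nonneg {L : ℕ} [NeZero L] (J h : ℝ) (β : ℝ≥0) (σ η : Config L) :
    0 ≤ transProb J h β σ η := by
  unfold transProb
  split_ifs
  · exact sub_nonneg.2 (sum_rate_le J h β σ)
  · exact rate_nonneg J h β σ η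

theorem sum_transProb {L : ℕ} [NeZero L] (J h : ℝ) (β : ℝ≥0) (σ : Config L) :
    ∑ η, transProb J h β σ η = 1 := by
  rw [← Finset.add_sum_erase _ _ (Finset.mem_univ σ)]
  have h1 : ∑ η ∈ Finset.univ.erase σ, transProb J h β σ η
      = ∑ η ∈ Finset.univ.erase σ, rate J h β σ η :=
    Finset.sum_congr rfl fun η hη => if_neg (Finset.ne_of_mem_erase hη).symm
  rw [h1]
  simp [transProb]

/-- The law of one step of the dynamics started at `σ`. -/
def stepPMF {L : ℕ} [NeZero L] (J h : ℝ) (β : ℝ≥0) (σ : Config L) : PMF (Config L) :=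
  PMF.ofFintype (fun η => ENNReal.ofReal (transProb J h β σ η)) (by
    rw [← ENNReal.ofReal_sum_of_nonneg fun η _ => transProb_nonneg J h β σ η, sum_transProb,
      ENNReal.ofReal_one])

instance : MeasurableSingletonClass ℤˣ where
  measurableSet_singleton u := by
    refine ⟨{(u : ℤ)}, MeasurableSet.of_discrete, ?_⟩
    ext v; simp [Units.val_inj]

/-- One step of the dynamics as a Markov kernel. -/
def stepKernel (L : ℕ) [NeZero L] (J h : ℝ) (β : ℝ≥0) :
    ProbabilityTheory.Kernel (Config L) (Config L) where
  toFun σ := (stepPMF J h β σ).toMeasure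
  measurable' := measurable_of_countable _

instance (L : ℕ) [NeZero L] (J h : ℝ) (β : ℝ≥0) :
    ProbabilityTheory.IsMarkovKernel (stepKernel L J h β) :=
  ⟨fun σ => by
    change MeasureTheory.IsProbabilityMeasure (stepPMF J h β σ).toMeasure
    infer_instance⟩

/-- The law of the step from time `n` to time `n + 1` given the trajectory up to time `n`:
it depends on the state at time `n` only. -/
def historyKernel (L : ℕ) [NeZero L] (J h : ℝ) (β : ℝ≥0) (n : ℕ) :
    ProbabilityTheory.Kernel (Finset.Iic n → Config L) (Config L) :=
  (stepKernel L J h β).comap (fun ω => ω ⟨n, Finset.mem_Iic.2 le_rfl⟩) (measurable_pi_apply _)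

instance (L : ℕ) [NeZero L] (J h : ℝ) (β : ℝ≥0) (n : ℕ) :
    ProbabilityTheory.IsMarkovKernel (historyKernel L J h β n) := by
  unfold historyKernel; infer_instance

/-- The law of the Markov chain `(X_t)` started at `σ`, on the space of trajectories. -/
def chainLaw {L : ℕ} [NeZero L] (J h : ℝ) (β : ℝ≥0) (σ : Config L) :
    MeasureTheory.Measure (ℕ → Config L) :=
  ProbabilityTheory.Kernel.trajMeasure (X := fun _ => Config L)
    (MeasureTheory.Measure.dirac σ) (historyKernel L J h β)

/-- The first hitting time `inf {t > 0 | X_t ∈ A}` along a trajectory (`⊤` if `A` is not hit). -/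
def hitTime {L : ℕ} (A : Set (Config L)) (ω : ℕ → Config L) : ℕ∞ :=
  ⨅ (t : ℕ) (_ : 0 < t ∧ ω t ∈ A), (t : ℕ∞)

/-- `P_σ (τ_A > T)`. -/
def hitTail {L : ℕ} [NeZero L] (J h : ℝ) (β : ℝ≥0) (σ : Config L) (A : Set (Config L))
    (T : ℝ) : ℝ≥0∞ :=
  chainLaw J h β σ {ω | ENNReal.ofReal T < (hitTime A ω : ℝ≥0∞)}

/-- Super-exponentially small functions of the inverse temperature: `log (f β) / β → -∞`, where
`log 0 = -∞`. -/
def IsSES (f : ℝ≥0 → ℝ≥0∞) : Prop :=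
  Filter.Tendsto (fun β : ℝ≥0 => ENNReal.log (f β) / ((β : ℝ) : EReal)) Filter.atTop (nhds ⊥)

end

end HexIsing

/-! The core is `escapes_of_ne`: a nonconstant configuration reaches lower energy without climbing
more than `2 * J`. Suppose that `σ` does not. Testing single flips near an interface shows that at
each vertex it goes straight on or turns by π/3 towards the plus phase (`IsBoundary.around`), so it
consists of straight sides.

Let a side between two corners have m + 1 edges. Peeling off the row of 2m + 3 pluses behind it
changes the energy by (2m + 3)h - J. Hence sides are long, J ≤ (2m + 3)h (`SideEdge.le_of_corner`),
and the inequality is strict by the non-integrality assumption. On sides that long, a row of pluses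
can be grown outside the interface: each edge gains 2h, and a completed side pays for turning the
corner. An unexpected plus next to a growing site would yield an escape, so the growth never stops,
which is absurd on a finite torus (`not_grow`). Without corners the growth simply runs straight on.
Since an unexpected spin always means an escape, neither self-collisions nor other clusters need any
global geometry.

Iterating the escape leads from any configuration to a constant one. All-plus is a global minimum,
and the first flip out of all-minus costs 3J - h > 2J; this gives the stable set. These paths also
bound the Dirichlet form of the killed chain from below (`exists_gap`), with gap at least
exp(-2Jβ)/C. By reversibility survival then decays in L² (`sum_sq_survival_le`), and at time
exp(β(2J + ε)) it is at most exp(-exp(βε)/(2C) + O(β)). -/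

namespace HexIsing

/-! ### The six triangles around a vertex -/

/-- The six lattice directions, in counterclockwise order. -/
def latticeDir (L : ℕ) : Fin 6 → ZMod L × ZMod L :=
  ![(1, 0), (0, 1), (-1, 1), (-1, 0), (0, -1), (1, -1)]

/-- The six triangles around the vertex `v`, in counterclockwise order: `cornerSite v k` lies
between the directions `k` and `k + 1`. -/
def cornerSite {L : ℕ} (v : ZMod L × ZMod L) : Fin 6 → Site L :=
  ![.inl v, .inr (v.1 - 1, v.2), .inl (v.1 - 1, v.2), .inr (v.1 - 1, v.2 - 1),
    .inl (v.1, v.2 - 1), .inr (v.1, v.2 - 1)]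

/-- A triangle is seen from each of its three vertices and so has three names. This identity and the
next one change the vertex, which is needed when moving along an interface. -/
theorem cornerSite_add_dir {L : ℕ} (v : ZMod L × ZMod L) (k : Fin 6) :
    cornerSite (v + latticeDir L k) (k + 2) = cornerSite v k := by
  obtain ⟨a, b⟩ := v
  fin_cases k <;> simp [cornerSite, latticeDir] <;> grind

theorem cornerSite_add_dir_succ {L : ℕ} (v : ZMod L × ZMod L) (k : Fin 6) :
    cornerSite (v + latticeDir L (k + 1)) (k + 4) = cornerSite v k := by
  obtain ⟨a, b⟩ := v
  fin_cases k <;> simp [cornerSite, latticeDir] <;> grind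

/-- Both sides are the triangle beyond the edge of `cornerSite v k` opposite to `v`, seen from the
two ends of that edge. -/
theorem cornerSite_add_dir_add_five {L : ℕ} (v : ZMod L × ZMod L) (k : Fin 6) :
    cornerSite (v + latticeDir L (k + 1)) (k + 5) =
      cornerSite (v + latticeDir L k) (k + 1) := by
  obtain ⟨a, b⟩ := v
  fin_cases k <;> simp [cornerSite, latticeDir] <;> grind

/-- The neighbours of the site `x` are the three distinct sites `a`, `b` and `c`. -/
structure HasNeighbors {L : ℕ} [NeZero L] (x a b c : Site L) : Prop where
  neighborFinset_eq : (hexTorus L).neighborFinset x = {a, b, c}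
  ne_ab : a ≠ b
  ne_ac : a ≠ c
  ne_bc : b ≠ c

/-- For `L = 1` the three neighbours coincide; this is where `hL` matters. -/
theorem hasNeighbors_inl {L : ℕ} [NeZero L] (hL : 2 ≤ L) (v : ZMod L × ZMod L) :
    HasNeighbors (.inl v : Site L) (.inr v) (.inr (v.1 - 1, v.2)) (.inr (v.1, v.2 - 1)) := by
  have : Fact (1 < L) := ⟨hL⟩
  obtain ⟨a, b⟩ := v
  constructor
  · ext x
    rw [SimpleGraph.mem_neighborFinset]
    rcases x with x | x
    · simp [hexTorus, SiteAdj]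
    · simp [hexTorus, SiteAdj, Touches]
  all_goals simp [Prod.ext_iff, eq_comm (a := a), eq_comm (a := b)]

theorem hasNeighbors_inr {L : ℕ} [NeZero L] (hL : 2 ≤ L) (v : ZMod L × ZMod L) :
    HasNeighbors (.inr v : Site L) (.inl v) (.inl (v.1 + 1, v.2)) (.inl (v.1, v.2 + 1)) := by
  have : Fact (1 < L) := ⟨hL⟩
  obtain ⟨a, b⟩ := v
  constructor
  · ext x
    rw [SimpleGraph.mem_neighborFinset]
    rcases x with x | x
    · simp only [hexTorus, SiteAdj, Touches, Finset.mem_insert, Finset.mem_singleton,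
        Sum.inl.injEq, Prod.ext_iff]
      grind
    · simp [hexTorus, SiteAdj]
  all_goals simp [Prod.ext_iff]

namespace HasNeighbors

variable {L : ℕ} [NeZero L] {x a b c : Site L}

theorem rotate (H : HasNeighbors x a b c) : HasNeighbors x b c a :=
  ⟨by rw [H.neighborFinset_eq]; ext; simp; tauto, H.ne_bc, H.ne_ab.symm, H.ne_ac.symm⟩

theorem swap (H : HasNeighbors x a b c) : HasNeighbors x b a c :=
  ⟨by rw [H.neighborFinset_eq]; ext; simp; tauto, H.ne_ab.symm, H.ne_bc, H.ne_ac⟩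

theorem ne_a (H : HasNeighbors x a b c) : a ≠ x := by
  have : a ∈ (hexTorus L).neighborFinset x := by rw [H.neighborFinset_eq]; simp
  exact ((hexTorus L).mem_neighborFinset x a).1 this |>.ne'

theorem ne_b (H : HasNeighbors x a b c) : b ≠ x := H.rotate.ne_a

theorem ne_c (H : HasNeighbors x a b c) : c ≠ x := H.rotate.rotate.ne_a

theorem sum_neighbors (H : HasNeighbors x a b c) (f : Site L → ℝ) :
    ∑ y ∈ (hexTorus L).neighborFinset x, f y = f a + f b + f c := by
  rw [H.neighborFinset_eq, Finset.sum_insert, Finset.sum_insert, Finset.sum_singleton, add_assoc]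
  · simpa using H.ne_bc
  · simp [H.ne_ab, H.ne_ac]

end HasNeighbors

theorem hasNeighbors_cornerSite {L : ℕ} [NeZero L] (hL : 2 ≤ L) (v : ZMod L × ZMod L)
    (k : Fin 6) : HasNeighbors (cornerSite v k) (cornerSite v (k + 5)) (cornerSite v (k + 1))
      (cornerSite (v + latticeDir L k) (k + 1)) := by
  obtain ⟨a, b⟩ := v
  fin_cases k
  · convert (hasNeighbors_inl hL (a, b)).swap.rotate.rotate using 1 <;>
      simp [cornerSite, latticeDir]
  · convert (hasNeighbors_inr hL (a - 1, b)).swap using 1 <;>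
      simp [cornerSite, latticeDir]
  · convert (hasNeighbors_inl hL (a - 1, b)).swap.rotate using 1 <;>
      simp [cornerSite, latticeDir]
    grind
  · convert (hasNeighbors_inr hL (a - 1, b - 1)).swap.rotate.rotate using 1 <;>
      simp [cornerSite, latticeDir]
    grind
  · convert (hasNeighbors_inl hL (a, b - 1)).swap using 1 <;>
      simp [cornerSite, latticeDir]
    grind
  · convert (hasNeighbors_inr hL (a, b - 1)).swap.rotate using 1 <;>
      simp [cornerSite, latticeDir]
    grind

theorem spinFlip_apply_of_ne {L : ℕ} (σ : Config L) {x y : Site L} (h : y ≠ x) :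
    spinFlip σ x y = σ y := Function.update_of_ne h _ _

theorem spinFlip_apply_self {L : ℕ} (σ : Config L) (x : Site L) :
    spinFlip σ x x = -σ x := Function.update_self _ _ _

/-- The energy difference of a single spin flip. -/
theorem energy_spinFlip {L : ℕ} [NeZero L] (J h : ℝ) (σ : Config L) (x : Site L) :
    energy J h (spinFlip σ x) - energy J h σ =
      spin σ x * (J * ∑ y ∈ (hexTorus L).neighborFinset x, spin σ y + h) := by
  classical
  have hs : ∀ y, spin (spinFlip σ x) y = spin σ y - if y = x then 2 * spin σ x else 0 := by
    intro y
    split_ifs with hy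
    · subst hy; simp [spin, spinFlip_apply_self]; ring
    · simp [spin, spinFlip_apply_of_ne σ hy]
  have h1 : ∑ i, spin (spinFlip σ x) i = ∑ i, spin σ i - 2 * spin σ x := by
    simp [hs]
  have h2 : ∑ e ∈ (hexTorus L).edgeFinset, (bondSpin (spinFlip σ x) e - bondSpin σ e) =
      ∑ y ∈ (hexTorus L).neighborFinset x, (-2 * (spin σ x * spin σ y)) := by
    -- Only the bonds at `x` change.
    rw [← Finset.sum_subset (s₁ := ((hexTorus L).neighborFinset x).image fun y => s(x, y))]
    · rw [Finset.sum_image]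
      · refine Finset.sum_congr rfl fun y hy => ?_
        have hne : y ≠ x := (((hexTorus L).mem_neighborFinset x y).1 hy).ne'
        simp only [bondSpin, Sym2.lift_mk, hs, if_neg hne, if_true]
        ring
      · intro y _ z _ hyz
        exact Sym2.congr_right.1 hyz
    · intro e he
      obtain ⟨y, hy, rfl⟩ := Finset.mem_image.1 he
      simpa using hy
    · intro e he hne
      induction e with
      | _ y z =>
        have hyz : (hexTorus L).Adj y z := by simpa using he
        have hy : y ≠ x := by
          rintro rfl
          exact hne (Finset.mem_image.2 ⟨z, by simpa using hyz, rfl⟩)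
        have hz : z ≠ x := by
          rintro rfl
          exact hne (Finset.mem_image.2 ⟨y, by simpa using hyz.symm, Sym2.eq_swap⟩)
        simp [bondSpin, hs, hy, hz]
  rw [Finset.sum_sub_distrib, ← Finset.mul_sum, ← Finset.mul_sum] at h2
  unfold energy
  rw [h1, sub_eq_iff_eq_add.1 h2]
  ring

theorem spin_eq_one_or {L : ℕ} (σ : Config L) (x : Site L) :
    spin σ x = 1 ∨ spin σ x = -1 := by
  rcases Int.units_eq_one_or (σ x) with h | h <;> simp [spin, h]

theorem spin_le_one {L : ℕ} (σ : Config L) (x : Site L) : spin σ x ≤ 1 := by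
  rcases spin_eq_one_or σ x with h | h <;> rw [h]; norm_num

theorem neg_one_le_spin {L : ℕ} (σ : Config L) (x : Site L) : -1 ≤ spin σ x := by
  rcases spin_eq_one_or σ x with h | h <;> rw [h]; norm_num

theorem energy_allPlus_le {L : ℕ} [NeZero L] {J h : ℝ} (hJ : 0 ≤ J) (hh : 0 ≤ h)
    (σ : Config L) : energy J h (allPlus L) ≤ energy J h σ := by
  have h1 : ∑ i, spin σ i ≤ ∑ i, spin (allPlus L) i :=
    Finset.sum_le_sum fun i _ => by simpa [spin, allPlus] using spin_le_one σ i
  have h2 : ∑ e ∈ (hexTorus L).edgeFinset, bondSpin σ e ≤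
      ∑ e ∈ (hexTorus L).edgeFinset, bondSpin (allPlus L) e := by
    refine Finset.sum_le_sum fun e _ => ?_
    induction e with
    | _ y z =>
      have : spin σ y * spin σ z ≤ 1 := by
        rcases spin_eq_one_or σ y with h | h <;> rcases spin_eq_one_or σ z with h' | h' <;>
          rw [h, h'] <;> norm_num
      simpa [bondSpin, spin, allPlus] using this
  unfold energy
  nlinarith

/-- A configuration that is constant around each vertex is constant. -/
theorem eq_const_of_corner {L : ℕ} [NeZero L] (σ : Config L)
    (H : ∀ v k, σ (cornerSite v k) = 1 → σ (cornerSite v (k + 5)) = 1) :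
    σ = allMinus L ∨ σ = allPlus L := by
  have H1 : ∀ v k j, σ (cornerSite v k) = σ (cornerSite v j) := by
    have H2 : ∀ v k, σ (cornerSite v k) = 1 → ∀ j, σ (cornerSite v j) = 1 := by
      intro v k hk j
      have a1 := H v k hk
      have a2 := H v (k + 5) a1
      have a3 := H v (k + 5 + 5) a2
      have a4 := H v (k + 5 + 5 + 5) a3
      have a5 := H v (k + 5 + 5 + 5 + 5) a4
      have : j = k ∨ j = k + 5 ∨ j = k + 5 + 5 ∨ j = k + 5 + 5 + 5 ∨ j = k + 5 + 5 + 5 + 5 ∨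
          j = k + 5 + 5 + 5 + 5 + 5 := by
        clear hk a1 a2 a3 a4 a5; revert j k; decide
      rcases this with rfl | rfl | rfl | rfl | rfl | rfl
      exacts [hk, a1, a2, a3, a4, a5]
    intro v k j
    rcases Int.units_eq_one_or (σ (cornerSite v k)) with h | h
    · rw [h, H2 v k h j]
    · rcases Int.units_eq_one_or (σ (cornerSite v j)) with h' | h'
      · rw [H2 v j h' k, h']
      · rw [h, h']
  have hx : ∀ a b : ZMod L, σ (.inl (a + 1, b)) = σ (.inl (a, b)) := by
    intro a b; simpa [cornerSite] using H1 (a + 1, b) 0 2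
  have hy : ∀ a b : ZMod L, σ (.inl (a, b + 1)) = σ (.inl (a, b)) := by
    intro a b; simpa [cornerSite] using H1 (a, b + 1) 0 4
  have hr : ∀ a b : ZMod L, σ (.inr (a, b)) = σ (.inl (a, b)) := by
    intro a b; simpa [cornerSite] using H1 (a + 1, b) 1 2
  have hx' : ∀ (n : ℕ) (b : ZMod L), σ (.inl ((n : ZMod L), b)) = σ (.inl (0, b)) := by
    intro n b
    induction n with
    | zero => simp
    | succ n ih => rw [Nat.cast_succ, hx, ih]
  have hy' : ∀ n : ℕ, σ (.inl (0, (n : ZMod L))) = σ (.inl (0, 0)) := by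
    intro n
    induction n with
    | zero => simp
    | succ n ih => rw [Nat.cast_succ, hy, ih]
  have hall : ∀ x, σ x = σ (.inl (0, 0)) := by
    have hl : ∀ a b : ZMod L, σ (.inl (a, b)) = σ (.inl (0, 0)) := by
      intro a b
      rw [← ZMod.natCast_zmod_val a, hx', ← ZMod.natCast_zmod_val b, hy']
    rintro (⟨a, b⟩ | ⟨a, b⟩)
    · exact hl a b
    · rw [hr, hl]
  rcases Int.units_eq_one_or (σ (.inl (0, 0))) with h | h
  · right; funext x; rw [hall, h]; rfl
  · left; funext x; rw [hall, h]; rfl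

/-! ### Descending paths -/

section Descent

/-- There is a path of single spin flips from `σ` to `η` of energy at most `B`. -/
def ConnectedBelow {L : ℕ} [NeZero L] (J h B : ℝ) (σ η : Config L) : Prop :=
  ∃ ω : (flipGraph L).Walk σ η, ∀ ζ ∈ ω.support, energy J h ζ ≤ B

/-- `σ` is connected below its energy plus `2 * J` to a configuration of lower energy. -/
def Escapes {L : ℕ} [NeZero L] (J h : ℝ) (σ : Config L) : Prop :=
  ∃ η, energy J h η < energy J h σ ∧ ConnectedBelow J h (energy J h σ + 2 * J) σ η

/-- `η` can be reached from `σ` below the energy of `σ` plus `2 * J`, and its energy exceeds that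
of `σ` by at most `E`. -/
def ReachedAt {L : ℕ} [NeZero L] (J h : ℝ) (σ η : Config L) (E : ℝ) : Prop :=
  ConnectedBelow J h (energy J h σ + 2 * J) σ η ∧ energy J h η ≤ energy J h σ + E

variable {L : ℕ} [NeZero L] {J h E : ℝ} {σ η : Config L} {x a b c : Site L}

theorem ConnectedBelow.refl {B : ℝ} (hB : energy J h σ ≤ B) : ConnectedBelow J h B σ σ :=
  ⟨.nil, by simpa using hB⟩

theorem ConnectedBelow.trans {B : ℝ} {ζ : Config L} (h₁ : ConnectedBelow J h B σ η)
    (h₂ : ConnectedBelow J h B η ζ) : ConnectedBelow J h B σ ζ := by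
  obtain ⟨ω₁, hω₁⟩ := h₁
  obtain ⟨ω₂, hω₂⟩ := h₂
  refine ⟨ω₁.append ω₂, fun ξ hξ => ?_⟩
  rcases SimpleGraph.Walk.mem_support_append_iff .. |>.1 hξ with hξ | hξ
  · exact hω₁ ξ hξ
  · exact hω₂ ξ hξ

theorem ConnectedBelow.mono {B B' : ℝ} (h₁ : ConnectedBelow J h B σ η) (hB : B ≤ B') :
    ConnectedBelow J h B' σ η :=
  let ⟨ω, hω⟩ := h₁
  ⟨ω, fun ζ hζ => (hω ζ hζ).trans hB⟩

theorem ConnectedBelow.spinFlip {B : ℝ} (h₁ : ConnectedBelow J h B σ η) (x : Site L)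
    (hx : energy J h (spinFlip η x) ≤ B) : ConnectedBelow J h B σ (spinFlip η x) := by
  refine h₁.trans ⟨.cons (show (flipGraph L).Adj η (HexIsing.spinFlip η x) from ⟨x, rfl⟩) .nil, ?_⟩
  obtain ⟨ω, hω⟩ := h₁
  simpa using ⟨hω _ ω.end_mem_support, hx⟩

theorem ReachedAt.refl (hJ : 0 ≤ J) : ReachedAt J h σ σ 0 :=
  ⟨.refl (by linarith), by simp⟩

theorem ReachedAt.mono {E' : ℝ} (R : ReachedAt J h σ η E) (hE : E ≤ E') :
    ReachedAt J h σ η E' := ⟨R.1, R.2.trans (by linarith)⟩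

theorem ReachedAt.spinFlip {d : ℝ} (R : ReachedAt J h σ η E)
    (hd : energy J h (spinFlip η x) - energy J h η ≤ d) (hE : E + d ≤ 2 * J) :
    ReachedAt J h σ (spinFlip η x) (E + d) := by
  have := R.2
  exact ⟨R.1.spinFlip x (by linarith), by linarith⟩

/-- Source of all contradictions below: a flip that would make `E` negative cannot be available,
which determines the spins of the neighbours. -/
theorem ReachedAt.nonneg (hσ : ¬ Escapes J h σ) (R : ReachedAt J h σ η E) : 0 ≤ E := by
  by_contra hE
  exact hσ ⟨η, by linarith [R.2], R.1⟩

theorem HasNeighbors.energy_spinFlip (N : HasNeighbors x a b c) (η : Config L) :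
    energy J h (spinFlip η x) - energy J h η =
      spin η x * (J * (spin η a + spin η b + spin η c) + h) := by
  rw [HexIsing.energy_spinFlip, N.sum_neighbors]

theorem spin_eq_one {L : ℕ} {η : Config L} {x : Site L} (hx : η x = 1) : spin η x = 1 := by simp [spin, hx]

theorem spin_eq_neg_one {L : ℕ} {η : Config L} {x : Site L} (hx : η x = -1) : spin η x = -1 := by simp [spin, hx]

theorem eq_neg_one_of_ne_one {L : ℕ} {η : Config L} {x : Site L} (hx : η x ≠ 1) : η x = -1 :=
  (Int.units_eq_one_or (η x)).resolve_left hx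

theorem eq_one_of_ne_neg_one {L : ℕ} {η : Config L} {x : Site L} (hx : η x ≠ -1) : η x = 1 :=
  (Int.units_eq_one_or (η x)).resolve_right hx

/-- Flipping a minus with one plus neighbour, in a configuration reached from a `σ` that does not
escape: the other two neighbours are minus. -/
theorem ReachedAt.grow_one (hJ : 0 ≤ J) (hσ : ¬ Escapes J h σ) (R : ReachedAt J h σ η E)
    (N : HasNeighbors x a b c) (hx : η x = -1) (ha : η a = 1) (hE : E + (J - h) < 2 * J) :
    η b = -1 ∧ η c = -1 ∧ ReachedAt J h σ (HexIsing.spinFlip η x) (E + (J - h)) := by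
  have hd := N.energy_spinFlip (J := J) (h := h) η
  rw [spin_eq_neg_one hx, spin_eq_one ha] at hd
  have hb := neg_one_le_spin η b
  have hc := neg_one_le_spin η c
  refine ⟨eq_neg_one_of_ne_one fun h1 => ?_, eq_neg_one_of_ne_one fun h1 => ?_, ?_⟩
  -- `hE` says E < J + h. This keeps the flip below the ceiling and also makes E - J - h negative,
  -- the energy after the flip if a second neighbour were plus. The three lemmas that follow use
  -- their `hE` in the same double way.
  · rw [spin_eq_one h1] at hd
    have := (R.spinFlip (x := x) (d := -J - h) (by rw [hd]; nlinarith) (by linarith)).nonneg hσ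
    linarith
  · rw [spin_eq_one h1] at hd
    have := (R.spinFlip (x := x) (d := -J - h) (by rw [hd]; nlinarith) (by linarith)).nonneg hσ
    linarith
  · exact R.spinFlip (by rw [hd]; nlinarith) hE.le

/-- Flipping a minus with two plus neighbours: the third neighbour is minus. -/
theorem ReachedAt.grow_two (hJ : 0 ≤ J) (hσ : ¬ Escapes J h σ) (R : ReachedAt J h σ η E)
    (N : HasNeighbors x a b c) (hx : η x = -1) (ha : η a = 1) (hb : η b = 1)
    (hE : E + (-J - h) < 2 * J) :
    η c = -1 ∧ ReachedAt J h σ (HexIsing.spinFlip η x) (E + (-J - h)) := by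
  have hd := N.energy_spinFlip (J := J) (h := h) η
  rw [spin_eq_neg_one hx, spin_eq_one ha, spin_eq_one hb] at hd
  have hc := neg_one_le_spin η c
  refine ⟨eq_neg_one_of_ne_one fun h1 => ?_, ?_⟩
  · rw [spin_eq_one h1] at hd
    have := (R.spinFlip (x := x) (d := -(3 * J) - h) (by rw [hd]; nlinarith)
      (by linarith)).nonneg hσ
    linarith
  · exact R.spinFlip (by rw [hd]; nlinarith) hE.le

/-- Flipping a plus with one minus neighbour: the other two neighbours are plus. -/
theorem ReachedAt.shrink_one (hJ : 0 ≤ J) (hσ : ¬ Escapes J h σ) (R : ReachedAt J h σ η E)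
    (N : HasNeighbors x a b c) (hx : η x = 1) (ha : η a = -1) (hE : E + (J + h) < 2 * J) :
    η b = 1 ∧ η c = 1 ∧ ReachedAt J h σ (HexIsing.spinFlip η x) (E + (J + h)) := by
  have hd := N.energy_spinFlip (J := J) (h := h) η
  rw [spin_eq_one hx, spin_eq_neg_one ha] at hd
  have hb := spin_le_one η b
  have hc := spin_le_one η c
  refine ⟨eq_one_of_ne_neg_one fun h1 => ?_, eq_one_of_ne_neg_one fun h1 => ?_, ?_⟩
  · rw [spin_eq_neg_one h1] at hd
    have := (R.spinFlip (x := x) (d := -J + h) (by rw [hd]; nlinarith) (by linarith)).nonneg hσ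
    linarith
  · rw [spin_eq_neg_one h1] at hd
    have := (R.spinFlip (x := x) (d := -J + h) (by rw [hd]; nlinarith) (by linarith)).nonneg hσ
    linarith
  · exact R.spinFlip (by rw [hd]; nlinarith) hE.le

/-- Flipping a plus with two minus neighbours: the third neighbour is plus. -/
theorem ReachedAt.shrink_two (hJ : 0 ≤ J) (hσ : ¬ Escapes J h σ) (R : ReachedAt J h σ η E)
    (N : HasNeighbors x a b c) (hx : η x = 1) (ha : η a = -1) (hb : η b = -1)
    (hE : E + (-J + h) < 2 * J) :
    η c = 1 ∧ ReachedAt J h σ (HexIsing.spinFlip η x) (E + (-J + h)) := by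
  have hd := N.energy_spinFlip (J := J) (h := h) η
  rw [spin_eq_one hx, spin_eq_neg_one ha, spin_eq_neg_one hb] at hd
  have hc := spin_le_one η c
  refine ⟨eq_one_of_ne_neg_one fun h1 => ?_, ?_⟩
  · rw [spin_eq_neg_one h1] at hd
    have := (R.spinFlip (x := x) (d := -(3 * J) + h) (by rw [hd]; nlinarith)
      (by linarith)).nonneg hσ
    linarith
  · exact R.spinFlip (by rw [hd]; nlinarith) hE.le

end Descent

/-! ### Following the boundary of the plus phase -/

section Boundary

/-- The edge leaving `v` in direction `k` separates a plus on its left from a minus on its right. -/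
def IsBoundary {L : ℕ} (σ : Config L) (v : ZMod L × ZMod L) (k : Fin 6) : Prop :=
  σ (cornerSite v k) = 1 ∧ σ (cornerSite v (k + 5)) = -1

/-- `(v, k)` is the boundary edge obtained by following the boundary through a corner of the plus
phase and then `m` times straight ahead. -/
inductive SideEdge {L : ℕ} (σ : Config L) : ZMod L × ZMod L → Fin 6 → ℕ → Prop
  | corner {v : ZMod L × ZMod L} {k : Fin 6} : IsBoundary σ v k → σ (cornerSite v (k + 2)) = -1 →
      SideEdge σ (v + latticeDir L (k + 2)) (k + 5) 0
  | straight {v : ZMod L × ZMod L} {k : Fin 6} {m : ℕ} : SideEdge σ v k m →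
      σ (cornerSite v (k + 2)) = 1 → SideEdge σ (v + latticeDir L (k + 3)) k (m + 1)

theorem cornerSite_corner_left {L : ℕ} (v : ZMod L × ZMod L) (k : Fin 6) :
    cornerSite (v + latticeDir L (k + 2)) (k + 5) = cornerSite v (k + 1) := by
  rw [show k + 5 = k + 1 + 4 by grind, show k + 2 = k + 1 + 1 by grind, cornerSite_add_dir_succ]

theorem cornerSite_corner_right {L : ℕ} (v : ZMod L × ZMod L) (k : Fin 6) :
    cornerSite (v + latticeDir L (k + 2)) (k + 5 + 5) = cornerSite v (k + 2) := by
  convert cornerSite_add_dir v (k + 2) using 2; grind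

theorem cornerSite_straight_left {L : ℕ} (v : ZMod L × ZMod L) (k : Fin 6) :
    cornerSite (v + latticeDir L (k + 3)) k = cornerSite v (k + 2) := by
  have := cornerSite_add_dir_succ v (k + 2)
  rwa [show k + 2 + 4 = k by grind, show k + 2 + 1 = k + 3 by grind] at this

theorem cornerSite_straight_right {L : ℕ} (v : ZMod L × ZMod L) (k : Fin 6) :
    cornerSite (v + latticeDir L (k + 3)) (k + 5) = cornerSite v (k + 3) := by
  convert cornerSite_add_dir v (k + 3) using 2; grind

theorem spinFlip_self_of_eq_neg_one {L : ℕ} {η : Config L} {x : Site L} (hx : η x = -1) :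
    spinFlip η x x = 1 := by simp [spinFlip_apply_self, hx]

theorem spinFlip_self_of_eq_one {L : ℕ} {η : Config L} {x : Site L} (hx : η x = 1) :
    spinFlip η x x = -1 := by simp [spinFlip_apply_self, hx]

theorem le_spinFlip {L : ℕ} {σ η : Config L} {x : Site L} (H : ∀ y, σ y = 1 → η y = 1)
    (hx : η x = -1) (y : Site L) (hy : σ y = 1) : spinFlip η x y = 1 := by
  rcases eq_or_ne y x with rfl | hne
  · exact spinFlip_self_of_eq_neg_one hx
  · rw [spinFlip_apply_of_ne _ hne, H y hy]

theorem spinFlip_le {L : ℕ} {σ η : Config L} {x : Site L} (H : ∀ y, σ y = -1 → η y = -1)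
    (hx : η x = 1) (y : Site L) (hy : σ y = -1) : spinFlip η x y = -1 := by
  rcases eq_or_ne y x with rfl | hne
  · exact spinFlip_self_of_eq_one hx
  · rw [spinFlip_apply_of_ne _ hne, H y hy]

variable {L : ℕ} [NeZero L] {J h E : ℝ} {σ : Config L} {v : ZMod L × ZMod L} {k : Fin 6} {m : ℕ}

theorem hasNeighbors_around (hL : 2 ≤ L) (v : ZMod L × ZMod L) {i j l : Fin 6} (hi : i = j + 5)
    (hl : l = j + 1) :
    HasNeighbors (cornerSite v j) (cornerSite v i) (cornerSite v l)
      (cornerSite (v + latticeDir L j) l) := by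
  subst hi hl
  exact hasNeighbors_cornerSite hL v j

theorem hasNeighbors_around' (hL : 2 ≤ L) (v : ZMod L × ZMod L) {i j l : Fin 6} (hi : i = j + 5)
    (hl : l = j + 1) :
    HasNeighbors (cornerSite v j) (cornerSite v i) (cornerSite v l)
      (cornerSite (v + latticeDir L l) i) := by
  subst hi hl
  rw [cornerSite_add_dir_add_five]
  exact hasNeighbors_cornerSite hL v j

/-- Around a vertex of the boundary of a configuration that does not escape, the boundary goes
straight ahead or turns towards the plus phase by the angle `π / 3`. -/
theorem IsBoundary.around (hL : 2 ≤ L) (hh : 0 < h) (hJ : 2 * h ≤ J) (hσ : ¬ Escapes J h σ)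
    (B : IsBoundary σ v k) : σ (cornerSite v (k + 4)) = -1 ∧ σ (cornerSite v (k + 3)) = -1 ∧
      σ (cornerSite v (k + 1)) = 1 ∧
      ReachedAt J h σ (spinFlip σ (cornerSite v (k + 5))) (J - h) := by
  obtain ⟨B0, B5⟩ := B
  have hJ0 : 0 ≤ J := by linarith
  have R0 : ReachedAt J h σ σ 0 := .refl hJ0
  have N5 := (hasNeighbors_around hL v (i := k + 4) (j := k + 5) (l := k)
    (by grind) (by grind)).swap
  have N4 := (hasNeighbors_around hL v (i := k + 3) (j := k + 4) (l := k + 5)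
    (by grind) (by grind)).swap
  have N0 := hasNeighbors_around hL v (i := k + 5) (j := k) (l := k + 1) (by grind) (by grind)
  -- Two successive flips on the minus side cost 2J - 2h < 2J and show that the sites `k + 4` and `k
  -- + 3` are minus. One flip on the plus side costs J + h < 2J and shows that `k + 1` is plus. Only
  -- `k + 2` stays free.
  obtain ⟨h4, -, R1⟩ := R0.grow_one hJ0 hσ N5 B5 B0 (by linarith)
  obtain ⟨h3, -, -⟩ := R1.grow_one hJ0 hσ N4
    (by rwa [spinFlip_apply_of_ne _ N5.ne_b]) (spinFlip_self_of_eq_neg_one B5) (by linarith)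
  rw [spinFlip_apply_of_ne _ N4.ne_ab.symm] at h3
  obtain ⟨h1, -, -⟩ := R0.shrink_one hJ0 hσ N0 B0 B5 (by linarith)
  exact ⟨h4, h3, h1, R1.mono (by linarith)⟩

theorem SideEdge.isBoundary (hL : 2 ≤ L) (hh : 0 < h) (hJ : 2 * h ≤ J) (hσ : ¬ Escapes J h σ)
    (S : SideEdge σ v k m) : IsBoundary σ v k := by
  induction S with
  | corner B h2 =>
    obtain ⟨-, -, h1, -⟩ := B.around hL hh hJ hσ
    exact ⟨by rwa [cornerSite_corner_left], by rwa [cornerSite_corner_right]⟩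
  | straight S h2 ih =>
    obtain ⟨-, h3, -, -⟩ := ih.around hL hh hJ hσ
    exact ⟨by rwa [cornerSite_straight_left], by rwa [cornerSite_straight_right]⟩

/-- Removing the row of pluses along a short side, up to the last site. -/
theorem SideEdge.shrink (hL : 2 ≤ L) (hh : 0 < h) (hJ : 2 * h ≤ J) (hσ : ¬ Escapes J h σ)
    (S : SideEdge σ v k m) (hm : (2 * m + 1) * h < J) :
    ∃ η, (∀ y, σ y = -1 → η y = -1) ∧ η (cornerSite v k) = -1 ∧ η (cornerSite v (k + 1)) = 1 ∧
      ReachedAt J h σ η (2 * (m + 1) * h) := by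
  have hJ0 : 0 ≤ J := by linarith
  induction S with
  | @corner v k B h2 =>
    obtain ⟨-, -, h1, -⟩ := B.around hL hh hJ hσ
    have N0 := hasNeighbors_around hL v (i := k + 5) (j := k) (l := k + 1) (by grind) (by grind)
    have N1 := hasNeighbors_around' hL v (i := k) (j := k + 1) (l := k + 2) (by grind) (by grind)
    -- The first flip costs J + h; the next site then has two minus neighbours and costs -J + h.
    -- Each edge of the side thus costs 2h in total.
    obtain ⟨-, -, R1⟩ := (ReachedAt.refl hJ0).shrink_one hJ0 hσ N0 B.1 B.2 (by linarith)
    have M1 := spinFlip_le (σ := σ) (fun _ => id) B.1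
    have e1 : spinFlip σ (cornerSite v k) (cornerSite v (k + 1)) = 1 := by
      rwa [spinFlip_apply_of_ne _ N0.ne_b]
    obtain ⟨h3, R2⟩ := R1.shrink_two hJ0 hσ N1 e1 (spinFlip_self_of_eq_one B.1) (M1 _ h2)
      (by linarith)
    refine ⟨_, spinFlip_le M1 e1, ?_, ?_, R2.mono (by push_cast; linarith)⟩
    · rw [cornerSite_corner_left, spinFlip_self_of_eq_one e1]
    · rw [show k + 5 + 1 = k by grind, spinFlip_apply_of_ne _ N1.ne_c, h3]
  | @straight v k m S h2 ih =>
    push_cast at hm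
    obtain ⟨η, M, e0, e1, R⟩ := ih (by nlinarith)
    obtain ⟨-, h3, -, -⟩ := (S.isBoundary hL hh hJ hσ).around hL hh hJ hσ
    have N1 := hasNeighbors_around hL v (i := k) (j := k + 1) (l := k + 2) (by grind) (by grind)
    have N2 := hasNeighbors_around' hL v (i := k + 1) (j := k + 2) (l := k + 3)
      (by grind) (by grind)
    obtain ⟨e2, -, R1⟩ := R.shrink_one hJ0 hσ N1 e1 e0 (by linarith)
    have M1 := spinFlip_le M e1
    have e2' : spinFlip η (cornerSite v (k + 1)) (cornerSite v (k + 2)) = 1 := by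
      rwa [spinFlip_apply_of_ne _ N1.ne_b]
    obtain ⟨e3, R2⟩ := R1.shrink_two hJ0 hσ N2 e2' (spinFlip_self_of_eq_one e1) (M1 _ h3)
      (by linarith)
    refine ⟨_, spinFlip_le M1 e2', ?_, ?_, R2.mono (by push_cast; linarith)⟩
    · rw [cornerSite_straight_left, spinFlip_self_of_eq_one e2']
    · rw [spinFlip_apply_of_ne _ N2.ne_c, e3]

/-- The sides of a configuration that does not escape are long. -/
theorem SideEdge.le_of_corner (hL : 2 ≤ L) (hh : 0 < h) (hJ : 2 * h ≤ J) (hσ : ¬ Escapes J h σ)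
    (S : SideEdge σ v k m) (h2 : σ (cornerSite v (k + 2)) = -1) : J ≤ (2 * m + 3) * h := by
  by_contra! hm
  have hJ0 : 0 ≤ J := by linarith
  obtain ⟨η, M, e0, e1, R⟩ := S.shrink hL hh hJ hσ (by linarith)
  have N1 := hasNeighbors_around hL v (i := k) (j := k + 1) (l := k + 2) (by grind) (by grind)
  -- At the far corner the last site of the row already has two minus neighbours, so the row ends
  -- without another barrier, at energy 2(m + 1)h - J + h.
  obtain ⟨-, R1⟩ := R.shrink_two hJ0 hσ N1 e1 e0 (M _ h2) (by linarith)
  linarith [R1.nonneg hσ]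

theorem card_minus_spinFlip_lt {η : Config L} {x : Site L} (hx : η x = -1) :
    (Finset.univ.filter fun y => spinFlip η x y = -1).card <
      (Finset.univ.filter fun y => η y = -1).card := by
  refine Finset.card_lt_card (Finset.ssubset_iff_of_subset ?_ |>.2 ⟨x, by simpa using hx, ?_⟩)
  · intro y hy
    rcases eq_or_ne y x with rfl | hne
    · simpa using hx
    · simpa [spinFlip_apply_of_ne _ hne] using hy
  · simp [spinFlip_self_of_eq_neg_one hx]

/-- Growing rows of pluses along the boundary, one side after the other, cannot go on forever. -/
theorem not_grow (hL : 2 ≤ L) (hh : 0 < h) (hJ : 2 * h ≤ J) (hσ : ¬ Escapes J h σ)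
    {P : ZMod L × ZMod L → Fin 6 → ℕ → Prop}
    (hstraight : ∀ v k m, P v k m → σ (cornerSite v (k + 2)) = 1 →
      P (v + latticeDir L (k + 3)) k (m + 1))
    (hcorner : ∀ v k m, P v k m → IsBoundary σ v k → σ (cornerSite v (k + 2)) = -1 →
      P (v + latticeDir L (k + 2)) (k + 5) 0 ∧ J < (2 * m + 3) * h)
    (n : ℕ) (η : Config L) (v : ZMod L × ZMod L) (k : Fin 6) (m : ℕ)
    (hn : (Finset.univ.filter fun y => η y = -1).card = n) (hP : P v k m)
    (B : IsBoundary σ v k) (M : ∀ y, σ y = 1 → η y = 1) (e5 : η (cornerSite v (k + 5)) = 1)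
    (e4 : η (cornerSite v (k + 4)) = -1) (R : ReachedAt J h σ η (J - h - 2 * m * h)) : False := by
  -- The number of minuses strictly decreases. The invariant: the site outside the current edge has
  -- been filled, the one ahead of it has not, and the excess energy is J - h less 2h for each edge
  -- already covered on this side.
  induction n using Nat.strong_induction_on generalizing η v k m with
  | _ n ih =>
    have hJ0 : 0 ≤ J := by linarith
    have hm0 : 0 ≤ 2 * m * h := by positivity
    obtain ⟨h4, h3, h1, -⟩ := B.around hL hh hJ hσ
    have N4 := (hasNeighbors_around hL v (i := k + 3) (j := k + 4) (l := k + 5)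
      (by grind) (by grind)).swap
    have N3 := (hasNeighbors_around hL v (i := k + 2) (j := k + 3) (l := k + 4)
      (by grind) (by grind)).swap
    have N2 := (hasNeighbors_around hL v (i := k + 1) (j := k + 2) (l := k + 3)
      (by grind) (by grind)).swap
    obtain ⟨e3, -, R1⟩ := R.grow_one hJ0 hσ N4 e4 e5 (by linarith)
    have M1 := le_spinFlip M e4
    have c1 := card_minus_spinFlip_lt e4
    have f4 := spinFlip_self_of_eq_neg_one e4
    have f3 : spinFlip η (cornerSite v (k + 4)) (cornerSite v (k + 3)) = -1 := by
      rwa [spinFlip_apply_of_ne _ N4.ne_b]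
    have c2 := card_minus_spinFlip_lt f3
    have M2 := le_spinFlip M1 f3
    rcases Int.units_eq_one_or (σ (cornerSite v (k + 2))) with h2 | h2
    -- Straight on: the pair of flips costs (J - h) + (-J - h) = -2h.
    · obtain ⟨e, R2⟩ := R1.grow_two hJ0 hσ N3 f3 f4 (M1 _ h2) (by linarith)
      refine ih _ (by omega) _ _ k (m + 1) rfl (hstraight v k m hP h2) ?_ M2 ?_ ?_
        (R2.mono (by push_cast; linarith))
      · exact ⟨by rwa [cornerSite_straight_left], by rwa [cornerSite_straight_right]⟩
      · rw [cornerSite_straight_right, spinFlip_self_of_eq_neg_one f3]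
      · rw [spinFlip_apply_of_ne _ N3.ne_c, e]
    · obtain ⟨hP', hlt⟩ := hcorner v k m hP B h2
      -- Around a corner there are two flips at J - h before one at -J - h. The peak is 3J - 3h -
      -- 2mh, below 2J exactly when J < (2m + 3)h; the same inequality brings the final energy under
      -- J - h, so the count restarts at 0.
      obtain ⟨e2, -, R2⟩ := R1.grow_one hJ0 hσ N3 f3 f4 (by linarith)
      have g2 : spinFlip (spinFlip η (cornerSite v (k + 4))) (cornerSite v (k + 3))
          (cornerSite v (k + 2)) = -1 := by
        rwa [spinFlip_apply_of_ne _ N3.ne_b]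
      obtain ⟨e, R3⟩ := R2.grow_two hJ0 hσ N2 g2 (spinFlip_self_of_eq_neg_one f3) (M2 _ h1)
        (by linarith)
      have c3 := card_minus_spinFlip_lt g2
      refine ih _ (by omega) _ _ (k + 5) 0 rfl hP' ?_ (le_spinFlip M2 g2) ?_ ?_
        (R3.mono (by push_cast; linarith))
      · exact ⟨by rwa [cornerSite_corner_left], by rwa [cornerSite_corner_right]⟩
      · rw [cornerSite_corner_right, spinFlip_self_of_eq_neg_one g2]
      · rw [show k + 5 + 4 = k + 3 by grind, spinFlip_apply_of_ne _ N2.ne_c, e]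

/-- Every configuration other than the two constant ones escapes. -/
theorem escapes_of_ne (hL : 2 ≤ L) (hh : 0 < h) (hJ : 2 * h ≤ J)
    (h_nonint : ∀ n : ℤ, J / (2 * h) - 1 / 2 ≠ (n : ℝ)) (hm : σ ≠ allMinus L)
    (hp : σ ≠ allPlus L) : Escapes J h σ := by
  by_contra hσ
  obtain ⟨v, k, B⟩ : ∃ v k, IsBoundary σ v k := by
    by_contra! hB
    refine (eq_const_of_corner σ fun v k hk => ?_).elim hm hp
    exact eq_one_of_ne_neg_one fun h5 => hB v k ⟨hk, h5⟩
  have start : ∀ (P : ZMod L × ZMod L → Fin 6 → ℕ → Prop) (v : ZMod L × ZMod L) (k : Fin 6),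
      (∀ v k m, P v k m → σ (cornerSite v (k + 2)) = 1 →
        P (v + latticeDir L (k + 3)) k (m + 1)) →
      (∀ v k m, P v k m → IsBoundary σ v k → σ (cornerSite v (k + 2)) = -1 →
        P (v + latticeDir L (k + 2)) (k + 5) 0 ∧ J < (2 * m + 3) * h) →
      P v k 0 → IsBoundary σ v k → False := by
    intro P v k hs hc hP B
    obtain ⟨h4, -, -, R⟩ := B.around hL hh hJ hσ
    have N5 := hasNeighbors_around hL v (i := k + 4) (j := k + 5) (l := k)
      (by grind) (by grind)
    -- Growth is seeded by one flipped minus next to the interface, at cost J - h.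
    refine not_grow hL hh hJ hσ hs hc _ _ v k 0 rfl hP B (le_spinFlip (fun _ => id) B.2)
      (spinFlip_self_of_eq_neg_one B.2) ?_ (R.mono (by simp))
    rwa [spinFlip_apply_of_ne _ N5.ne_a]
  by_cases hc : ∃ v k, IsBoundary σ v k ∧ σ (cornerSite v (k + 2)) = -1
  · obtain ⟨v, k, B, h2⟩ := hc
    have S := SideEdge.corner B h2
    -- Starting just after a corner makes `m` count each side from its beginning, as the length
    -- bound requires.
    refine start (SideEdge σ) _ _ (fun v k m S h2 => S.straight h2) (fun v k m S B h2 => ?_) S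
      (S.isBoundary hL hh hJ hσ)
    refine ⟨.corner B h2, (S.le_of_corner hL hh hJ hσ h2).lt_of_ne fun heq => ?_⟩
    -- J = (2m + 3)h would mean J/(2h) - 1/2 = m + 1.
    apply h_nonint (m + 1)
    rw [heq]
    field_simp
    push_cast
    ring
  · push Not at hc
    -- Without corners nothing has to be recorded about the sides: the turning case is vacuous.
    exact start (fun _ _ _ => True) v k (fun _ _ _ _ _ => trivial)
      (fun v k m _ B h2 => absurd h2 (hc v k B)) trivial B

end Boundary

/-! ### Survival probabilities of reversible finite Markov chains -/

section Survival

variable {X : Type*}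

open Classical in
/-- The function equal to `f` outside `A` and to `0` on `A`. -/
noncomputable def killedOn (A : Set X) (f : X → ℝ) (x : X) : ℝ := if x ∈ A then 0 else f x

theorem killedOn_of_mem {A : Set X} {x : X} (hx : x ∈ A) (f : X → ℝ) : killedOn A f x = 0 :=
  if_pos hx

theorem killedOn_of_notMem {A : Set X} {x : X} (hx : x ∉ A) (f : X → ℝ) :
    killedOn A f x = f x := if_neg hx

theorem killedOn_mono {A : Set X} {f g : X → ℝ} {x : X} (h : f x ≤ g x) :
    killedOn A f x ≤ killedOn A g x := by
  unfold killedOn; split_ifs <;> simp [h]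

theorem killedOn_nonneg {A : Set X} {f : X → ℝ} {x : X} (h : 0 ≤ f x) : 0 ≤ killedOn A f x := by
  unfold killedOn; split_ifs <;> simp [h]

theorem killedOn_le_one {A : Set X} {f : X → ℝ} {x : X} (h : f x ≤ 1) : killedOn A f x ≤ 1 := by
  unfold killedOn; split_ifs <;> simp [h]

variable [Fintype X]

/-- The probability that the chain with transition matrix `p` started at `x` is outside `A` at
the times `1, …, n`. -/
noncomputable def survival (p : X → X → ℝ) (A : Set X) : ℕ → X → ℝ
  | 0, _ => 1
  | n + 1, x => ∑ y, p x y * killedOn A (survival p A n) y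

/-- The Dirichlet form of the chain with transition matrix `p` and weights `μ`. -/
noncomputable def dirichletForm (p : X → X → ℝ) (μ : X → ℝ) (f : X → ℝ) : ℝ :=
  (∑ x, ∑ y, μ x * p x y * (f x - f y) ^ 2) / 2

variable {p : X → X → ℝ} {A : Set X} {μ : X → ℝ}

theorem survival_nonneg (hp : ∀ x y, 0 ≤ p x y) (n : ℕ) (x : X) : 0 ≤ survival p A n x := by
  induction n generalizing x with
  | zero => simp [survival]
  | succ n ih =>
    exact Finset.sum_nonneg fun y _ => mul_nonneg (hp x y) (killedOn_nonneg (ih y))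

theorem survival_succ_le (hp : ∀ x y, 0 ≤ p x y) (hp1 : ∀ x, ∑ y, p x y = 1) (n : ℕ) (x : X) :
    survival p A (n + 1) x ≤ survival p A n x := by
  induction n generalizing x with
  | zero =>
    simp only [survival]
    refine (Finset.sum_le_sum fun y _ => ?_).trans (hp1 x).le
    exact mul_le_of_le_one_right (hp x y) (killedOn_le_one le_rfl)
  | succ n ih =>
    exact Finset.sum_le_sum fun y _ => mul_le_mul_of_nonneg_left (killedOn_mono (ih y)) (hp x y)

theorem dirichletForm_eq (hp1 : ∀ x, ∑ y, p x y = 1) (hrev : ∀ x y, μ x * p x y = μ y * p y x)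
    (f : X → ℝ) :
    dirichletForm p μ f = ∑ x, μ x * f x ^ 2 - ∑ x, μ x * f x * ∑ y, p x y * f y := by
  have h1 : ∑ x, ∑ y, μ x * p x y * f x ^ 2 = ∑ x, μ x * f x ^ 2 := by
    refine Finset.sum_congr rfl fun x _ => ?_
    rw [← Finset.sum_mul, ← Finset.mul_sum, hp1, mul_one]
  have h2 : ∑ x, ∑ y, μ x * p x y * f y ^ 2 = ∑ x, μ x * f x ^ 2 := by
    rw [Finset.sum_comm, ← h1]
    exact Finset.sum_congr rfl fun x _ => Finset.sum_congr rfl fun y _ => by rw [hrev]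
  have h3 : ∑ x, ∑ y, μ x * p x y * (f x * f y) = ∑ x, μ x * f x * ∑ y, p x y * f y := by
    refine Finset.sum_congr rfl fun x _ => ?_
    rw [Finset.mul_sum]
    exact Finset.sum_congr rfl fun y _ => by ring
  have h4 : ∑ x, ∑ y, μ x * p x y * (f x - f y) ^ 2 =
      ∑ x, ∑ y, μ x * p x y * f x ^ 2 + ∑ x, ∑ y, μ x * p x y * f y ^ 2 -
        2 * ∑ x, ∑ y, μ x * p x y * (f x * f y) := by
    simp only [Finset.mul_sum, ← Finset.sum_add_distrib, ← Finset.sum_sub_distrib]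
    exact Finset.sum_congr rfl fun x _ => Finset.sum_congr rfl fun y _ => by ring
  rw [dirichletForm, h4, h1, h2, h3]
  ring

theorem edge_le_dirichletForm (hp : ∀ x y, 0 ≤ p x y) (hμ : ∀ x, 0 ≤ μ x) (f : X → ℝ) (x y : X) :
    μ x * p x y * (f x - f y) ^ 2 ≤ 2 * dirichletForm p μ f := by
  have h0 : ∀ a b, 0 ≤ μ a * p a b * (f a - f b) ^ 2 := fun a b =>
    mul_nonneg (mul_nonneg (hμ a) (hp a b)) (sq_nonneg _)
  calc μ x * p x y * (f x - f y) ^ 2 ≤ ∑ b, μ x * p x b * (f x - f b) ^ 2 :=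
        Finset.single_le_sum (f := fun b => μ x * p x b * (f x - f b) ^ 2)
          (fun b _ => h0 x b) (Finset.mem_univ y)
    _ ≤ ∑ a, ∑ b, μ a * p a b * (f a - f b) ^ 2 :=
        Finset.single_le_sum (f := fun a => ∑ b, μ a * p a b * (f a - f b) ^ 2)
          (fun a _ => Finset.sum_nonneg fun b _ => h0 a b) (Finset.mem_univ x)
    _ = 2 * dirichletForm p μ f := by unfold dirichletForm; ring

/-- The spectral gap of the chain killed on `A` bounds the survival probabilities. -/
theorem sum_sq_survival_le (hp : ∀ x y, 0 ≤ p x y) (hp1 : ∀ x, ∑ y, p x y = 1)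
    (hμ : ∀ x, 0 ≤ μ x) (hrev : ∀ x y, μ x * p x y = μ y * p y x) {l : ℝ}
    (hgap : ∀ f : X → ℝ, (∀ x ∈ A, f x = 0) → l * ∑ x, μ x * f x ^ 2 ≤ dirichletForm p μ f)
    (n : ℕ) :
    ∑ x, μ x * killedOn A (survival p A n) x ^ 2 ≤ Real.exp (-l * n) * ∑ x, μ x := by
  induction n with
  | zero =>
    rw [Nat.cast_zero, mul_zero, Real.exp_zero, one_mul]
    refine Finset.sum_le_sum fun x _ => mul_le_of_le_one_right (hμ x) ?_
    exact pow_le_one₀ (killedOn_nonneg (survival_nonneg hp 0 x)) (killedOn_le_one le_rfl)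
  | succ n ih =>
    set f := killedOn A (survival p A n) with hf
    -- Survival decreases in time, so f_{n+1}² ≤ f_n · f_{n+1}. The right side is ⟨f_n, P f_n⟩, that
    -- is ‖f_n‖² minus the Dirichlet form. No control of negative eigenvalues is needed.
    have h1 : ∑ x, μ x * killedOn A (survival p A (n + 1)) x ^ 2 ≤
        ∑ x, μ x * f x * ∑ y, p x y * f y := by
      refine Finset.sum_le_sum fun x _ => ?_
      by_cases hx : x ∈ A
      · simp [hf, killedOn_of_mem hx]
      · rw [killedOn_of_notMem hx, hf, killedOn_of_notMem hx, mul_assoc, sq]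
        exact mul_le_mul_of_nonneg_left (mul_le_mul_of_nonneg_right (survival_succ_le hp hp1 n x)
          (survival_nonneg hp (n + 1) x)) (hμ x)
    have h2 := dirichletForm_eq hp1 hrev f
    have h3 := hgap f fun x hx => killedOn_of_mem hx _
    have h4 : 0 ≤ ∑ x, μ x * f x ^ 2 :=
      Finset.sum_nonneg fun x _ => mul_nonneg (hμ x) (sq_nonneg _)
    have h5 : 1 - l ≤ Real.exp (-l) := Real.one_sub_le_exp_neg l
    calc _ ≤ (1 - l) * ∑ x, μ x * f x ^ 2 := by linarith
      _ ≤ Real.exp (-l) * ∑ x, μ x * f x ^ 2 := mul_le_mul_of_nonneg_right h5 h4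
      _ ≤ Real.exp (-l) * (Real.exp (-l * n) * ∑ x, μ x) :=
          mul_le_mul_of_nonneg_left ih (Real.exp_pos _).le
      _ = _ := by
          rw [← mul_assoc, ← Real.exp_add]
          congr 2
          push_cast
          ring

/-- The L² bound becomes pointwise at the price `K` of the smallest weight. One extra step averages
over the first move, since the starting point itself may lie in `A`. -/
theorem survival_succ_sq_le (hp : ∀ x y, 0 ≤ p x y) (hp1 : ∀ x, ∑ y, p x y = 1)
    (hμ : ∀ x, 0 < μ x) (hrev : ∀ x y, μ x * p x y = μ y * p y x) {l K : ℝ}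
    (hgap : ∀ f : X → ℝ, (∀ x ∈ A, f x = 0) → l * ∑ x, μ x * f x ^ 2 ≤ dirichletForm p μ f)
    (hK : ∀ x, ∑ y, μ y ≤ K * μ x) (n : ℕ) (x : X) :
    survival p A (n + 1) x ^ 2 ≤ Real.exp (-l * n) * K := by
  have h1 := sum_sq_survival_le hp hp1 (fun x => (hμ x).le) hrev hgap n
  have h2 : ∀ y, killedOn A (survival p A n) y ^ 2 ≤ Real.exp (-l * n) * K := by
    intro y
    have h3 : μ y * killedOn A (survival p A n) y ^ 2 ≤
        ∑ x, μ x * killedOn A (survival p A n) x ^ 2 :=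
      Finset.single_le_sum (f := fun x => μ x * killedOn A (survival p A n) x ^ 2)
        (fun z _ => mul_nonneg (hμ z).le (sq_nonneg _)) (Finset.mem_univ y)
    have h4 := mul_le_mul_of_nonneg_left (hK y) (Real.exp_pos (-l * n)).le
    refine le_of_mul_le_mul_left ?_ (hμ y)
    calc _ ≤ _ := h3.trans (h1.trans h4)
      _ = _ := by ring
  have hB : 0 ≤ Real.exp (-l * n) * K := (sq_nonneg _).trans (h2 x)
  have h5 : survival p A (n + 1) x ≤ √(Real.exp (-l * n) * K) := by
    calc _ ≤ ∑ y, p x y * √(Real.exp (-l * n) * K) :=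
          Finset.sum_le_sum fun y _ =>
            mul_le_mul_of_nonneg_left (Real.le_sqrt_of_sq_le (h2 y)) (hp x y)
      _ = _ := by rw [← Finset.sum_mul, hp1, one_mul]
  exact (Real.le_sqrt (survival_nonneg hp _ x) hB).1 h5

end Survival

/-! ### The hitting time of the Metropolis chain -/

section Chain

open MeasureTheory ProbabilityTheory

variable {L : ℕ} [NeZero L] (J h : ℝ) (β : ℝ≥0) (σ : Config L) (A : Set (Config L))

theorem lintegral_chainLaw_zero (φ : Config L → ℝ≥0∞) :
    ∫⁻ ω, φ (ω 0) ∂(chainLaw J h β σ) = φ σ := by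
  have h1 : (chainLaw J h β σ).map (Preorder.frestrictLe 0) =
      (Measure.dirac σ).map (MeasurableEquiv.piUnique
        (fun _ : Finset.Iic 0 => Config L)).symm := by
    rw [chainLaw, Kernel.trajMeasure, Measure.map_comp _ _ (by fun_prop),
      Kernel.traj_map_frestrictLe, Kernel.partialTraj_self, Measure.id_comp]
  have h2 : ∫⁻ ω, φ (ω 0) ∂(chainLaw J h β σ) =
      ∫⁻ x, φ (x ⟨0, by simp⟩) ∂((chainLaw J h β σ).map (Preorder.frestrictLe 0)) := by
    rw [lintegral_map (measurable_of_countable _) (by fun_prop)]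
    rfl
  rw [h2, h1, lintegral_map (measurable_of_countable _) (by fun_prop), lintegral_dirac]
  rfl

/-- The Markov property, in the form used to peel off the last step. -/
theorem lintegral_chainLaw_succ (n : ℕ) (F : (Finset.Iic n → Config L) × Config L → ℝ≥0∞) :
    ∫⁻ ω, F (Preorder.frestrictLe n ω, ω (n + 1)) ∂(chainLaw J h β σ) =
      ∫⁻ ω, ∑ η, F (Preorder.frestrictLe n ω, η) * stepPMF J h β (ω n) η
        ∂(chainLaw J h β σ) := by
  have h1 := Kernel.map_frestrictLe_trajMeasure_compProd_eq_map_trajMeasure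
    (X := fun _ => Config L) (μ₀ := Measure.dirac σ) (κ := historyKernel L J h β) (a := n)
  have h2 : ∫⁻ ω, F (Preorder.frestrictLe n ω, ω (n + 1)) ∂(chainLaw J h β σ) =
      ∫⁻ x, F x ∂((chainLaw J h β σ).map
        (fun x => (Preorder.frestrictLe n x, x (n + 1)))) := by
    rw [lintegral_map (measurable_of_countable _) (by fun_prop)]
  rw [h2, chainLaw, ← h1, Measure.lintegral_compProd (measurable_of_countable _),
    lintegral_map (measurable_of_countable _) (by fun_prop)]
  refine lintegral_congr fun ω => ?_
  rw [lintegral_fintype]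
  refine Finset.sum_congr rfl fun η _ => ?_
  congr 1
  exact PMF.toMeasure_apply_singleton _ _ (measurableSet_singleton η)

open Classical in
theorem lintegral_avoid_succ (n : ℕ) (φ : Config L → ℝ≥0∞) :
    ∫⁻ ω, (if ∀ t, 0 < t → t ≤ n + 1 → ω t ∉ A then φ (ω (n + 1)) else 0)
        ∂(chainLaw J h β σ) =
      ∫⁻ ω, (if ∀ t, 0 < t → t ≤ n → ω t ∉ A then
        ∑ η, stepPMF J h β (ω n) η * (if η ∈ A then 0 else φ η) else 0)
        ∂(chainLaw J h β σ) := by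
  have h1 := lintegral_chainLaw_succ J h β σ n fun x =>
    if (∀ t (ht : t ≤ n), 0 < t → x.1 ⟨t, Finset.mem_Iic.2 ht⟩ ∉ A) ∧ x.2 ∉ A then φ x.2 else 0
  convert h1 using 2 with ω ω
  · ext ω
    congr 1
    simp only [Preorder.frestrictLe_apply, eq_iff_iff]
    constructor
    · exact fun H => ⟨fun t ht h0 => H t h0 (by omega), H _ (by omega) le_rfl⟩
    · rintro ⟨H, H'⟩ t h0 ht
      rcases Nat.lt_or_eq_of_le ht with h | rfl
      · exact H t (by omega) h0
      · exact H'
  · ext ω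
    by_cases hω : ∀ t, 0 < t → t ≤ n → ω t ∉ A
    · rw [if_pos hω]
      refine Finset.sum_congr rfl fun η _ => ?_
      by_cases hη : η ∈ A
      · rw [if_pos hη]
        split_ifs with H
        · exact absurd hη H.2
        · rw [mul_zero, zero_mul]
      · rw [if_neg hη]
        split_ifs with H
        · exact mul_comm _ _
        · exact absurd ⟨fun t a b => hω t b a, hη⟩ H
    · rw [if_neg hω]
      refine (Finset.sum_eq_zero fun η _ => ?_).symm
      split_ifs with H
      · exact absurd (fun t a b => H.1 t b a) hω
      · exact zero_mul _

open Classical in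
-- Interpolates between the recursion (`n = 0`) and the avoidance probability on trajectories (`k =
-- 0`).
theorem lintegral_avoid (n k : ℕ) :
    ∫⁻ ω, (if ∀ t, 0 < t → t ≤ n → ω t ∉ A then
        ENNReal.ofReal (survival (transProb J h β) A k (ω n)) else 0) ∂(chainLaw J h β σ) =
      ENNReal.ofReal (survival (transProb J h β) A (n + k) σ) := by
  induction n generalizing k with
  | zero =>
    rw [zero_add, ← lintegral_chainLaw_zero J h β σ fun η =>
      ENNReal.ofReal (survival (transProb J h β) A k η)]
    refine lintegral_congr fun ω => if_pos fun t h0 ht => by omega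
  | succ n ih =>
    rw [lintegral_avoid_succ J h β σ A n fun η =>
      ENNReal.ofReal (survival (transProb J h β) A k η), add_right_comm n 1 k, add_assoc n k 1,
      ← ih]
    refine lintegral_congr fun ω => ?_
    congr 1
    rw [survival, ENNReal.ofReal_sum_of_nonneg]
    · refine Finset.sum_congr rfl fun η _ => ?_
      rw [ENNReal.ofReal_mul (transProb_nonneg J h β _ _), killedOn]
      split_ifs <;> simp [stepPMF]
    · exact fun η _ => mul_nonneg (transProb_nonneg J h β _ _)
        (killedOn_nonneg (survival_nonneg (transProb_nonneg J h β) k η))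

theorem hitTail_le_survival {T : ℝ} {n : ℕ} (hn : (n : ℝ) ≤ T) :
    hitTail J h β σ A T ≤ ENNReal.ofReal (survival (transProb J h β) A n σ) := by
  classical
  have h1 := lintegral_avoid J h β σ A n 0
  simp only [survival, ENNReal.ofReal_one, add_zero] at h1
  have hS : MeasurableSet {ω : ℕ → Config L | ∀ t, 0 < t → t ≤ n → ω t ∉ A} := by
    simp only [Set.ofPred_forall]
    exact .iInter fun t => .iInter fun _ => .iInter fun _ =>
      (Set.to_countable Aᶜ).measurableSet.preimage (measurable_pi_apply t)
  have h2 : ∫⁻ ω, (if ∀ t, 0 < t → t ≤ n → ω t ∉ A then 1 else 0) ∂(chainLaw J h β σ) =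
      chainLaw J h β σ {ω | ∀ t, 0 < t → t ≤ n → ω t ∉ A} := by
    rw [← lintegral_indicator_one hS]
    exact lintegral_congr fun ω => by simp [Set.indicator_apply]
  rw [← h1, h2]
  refine measure_mono fun ω hω t h0 ht hA => ?_
  have h3 : hitTime A ω ≤ (t : ℕ∞) := iInf₂_le t ⟨h0, hA⟩
  have h4 : ((hitTime A ω : ℕ∞) : ℝ≥0∞) ≤ (t : ℝ≥0∞) := by exact_mod_cast h3
  have h5 : (t : ℝ≥0∞) ≤ ENNReal.ofReal T := by
    rw [← ENNReal.ofReal_natCast]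
    exact ENNReal.ofReal_le_ofReal (le_trans (by exact_mod_cast ht) hn)
  exact absurd hω (not_lt.2 (h4.trans h5))

end Chain

/-! ### Reversibility and the spectral gap -/

section Gap

variable {L : ℕ} [NeZero L] {J h : ℝ} {β : ℝ≥0}

/-- The unnormalised Gibbs weight. -/
noncomputable def gibbsWeight (J h : ℝ) (β : ℝ≥0) (σ : Config L) : ℝ :=
  Real.exp (-(β * energy J h σ))

theorem gibbsWeight_pos (σ : Config L) : 0 < gibbsWeight J h β σ := Real.exp_pos _

theorem connectivity_comm (σ η : Config L) : connectivity σ η = connectivity η σ := by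
  have : (∃ x, spinFlip σ x = η) ↔ ∃ x, spinFlip η x = σ :=
    ⟨fun H => (SimpleGraph.Adj.symm (G := flipGraph L) H), fun H => (SimpleGraph.Adj.symm (G := flipGraph L) H)⟩
  simp only [connectivity, this]

theorem gibbsWeight_mul_rate (σ η : Config L) :
    gibbsWeight J h β σ * rate J h β σ η =
      connectivity σ η * Real.exp (-(β * max (energy J h σ) (energy J h η))) := by
  rw [gibbsWeight, rate, mul_left_comm, ← Real.exp_add]
  congr 2
  rcases le_total (energy J h σ) (energy J h η) with H | H
  · rw [max_eq_left (sub_nonneg.2 H), max_eq_right H]; ring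
  · rw [max_eq_right (sub_nonpos.2 H), max_eq_left H]; ring

theorem gibbsWeight_mul_transProb_comm (σ η : Config L) :
    gibbsWeight J h β σ * transProb J h β σ η = gibbsWeight J h β η * transProb J h β η σ := by
  rcases eq_or_ne σ η with rfl | hne
  · rfl
  · rw [transProb, transProb, if_neg hne, if_neg hne.symm, gibbsWeight_mul_rate,
      gibbsWeight_mul_rate, connectivity_comm, max_comm]

/-- The variation of a function along a path is controlled by its Dirichlet form. -/
theorem abs_sub_le_of_walk {σ η : Config L} {B : ℝ} (f : Config L → ℝ)
    (ω : (flipGraph L).Walk σ η) (hω : ∀ ζ ∈ ω.support, energy J h ζ ≤ B) :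
    |f σ - f η| ≤ ω.length * √(2 * Fintype.card (Site L) * Real.exp (β * B) *
      dirichletForm (transProb J h β) (gibbsWeight J h β) f) := by
  induction ω with
  | nil => simp
  | @cons σ ζ η hadj ω ih =>
    have ih' := ih fun ξ hξ => hω ξ (by simp [hξ])
    have hσ : energy J h σ ≤ B := hω σ (by simp)
    have hζ : energy J h ζ ≤ B := hω ζ (by simp)
    have h1 := edge_le_dirichletForm (transProb_nonneg J h β)
      (fun σ => (gibbsWeight_pos (J := J) (h := h) (β := β) σ).le) f σ ζ
    have hN : (0 : ℝ) < Fintype.card (Site L) := by exact_mod_cast Fintype.card_pos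
    rw [transProb, if_neg hadj.ne, gibbsWeight_mul_rate, connectivity,
      if_pos (show ∃ x, spinFlip σ x = ζ from hadj)] at h1
    -- Every edge of the path has conductance at least exp(-βB)/|Λ|, so a single edge term already
    -- bounds the increment of `f`.
    have h2 : Real.exp (-(β * B)) ≤
        Real.exp (-(β * max (energy J h σ) (energy J h ζ))) :=
      Real.exp_le_exp.2 (neg_le_neg (mul_le_mul_of_nonneg_left (max_le hσ hζ) β.2))
    have h3 : (f σ - f ζ) ^ 2 ≤ 2 * Fintype.card (Site L) * Real.exp (β * B) *
        dirichletForm (transProb J h β) (gibbsWeight J h β) f := by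
      have h4 : 1 / (Fintype.card (Site L) : ℝ) * Real.exp (-(β * B)) * (f σ - f ζ) ^ 2 ≤
          2 * dirichletForm (transProb J h β) (gibbsWeight J h β) f :=
        le_trans (by gcongr) h1
      have h5 := mul_le_mul_of_nonneg_left h4
        (show 0 ≤ Fintype.card (Site L) * Real.exp (β * B) by positivity)
      rw [Real.exp_neg] at h5
      field_simp at h5
      linarith
    have h6 : |f σ - f ζ| ≤ √(2 * Fintype.card (Site L) * Real.exp (β * B) *
        dirichletForm (transProb J h β) (gibbsWeight J h β) f) := Real.abs_le_sqrt h3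
    calc |f σ - f η| ≤ |f σ - f ζ| + |f ζ - f η| := abs_sub_le _ _ _
      _ ≤ _ := add_le_add h6 ih'
      _ = _ := by rw [SimpleGraph.Walk.length_cons]; push_cast; ring

/-- If every configuration is connected to `A` below its energy plus `V`, the spectral gap of the
chain killed on `A` is at least of order `exp (-β V)`. -/
theorem exists_gap {A : Set (Config L)} {V : ℝ}
    (hA : ∀ σ, ∃ η ∈ A, ConnectedBelow J h (energy J h σ + V) σ η) :
    ∃ C : ℝ, 0 < C ∧ ∀ (β : ℝ≥0) (f : Config L → ℝ), (∀ σ ∈ A, f σ = 0) →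
      (C * Real.exp (β * V))⁻¹ * ∑ σ, gibbsWeight J h β σ * f σ ^ 2 ≤
        dirichletForm (transProb J h β) (gibbsWeight J h β) f := by
  choose a ha w hw using hA
  -- The paths are chosen before `β`, so the constant does not depend on it; the `+ 1` only ensures
  -- positivity.
  refine ⟨∑ σ, 2 * ((w σ).length : ℝ) ^ 2 * Fintype.card (Site L) + 1, by positivity,
    fun β f hf => ?_⟩
  set D := dirichletForm (transProb J h β) (gibbsWeight J h β) f with hD
  have hD0 : 0 ≤ D := by
    refine div_nonneg (Finset.sum_nonneg fun x _ => Finset.sum_nonneg fun y _ => ?_) zero_le_two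
    exact mul_nonneg (mul_nonneg (gibbsWeight_pos x).le (transProb_nonneg J h β x y))
      (sq_nonneg _)
  have h1 : ∀ σ, gibbsWeight J h β σ * f σ ^ 2 ≤
      2 * ((w σ).length : ℝ) ^ 2 * Fintype.card (Site L) * (Real.exp (β * V) * D) := by
    intro σ
    have h2 := abs_sub_le_of_walk (β := β) f (w σ) (hw σ)
    rw [hf _ (ha σ), sub_zero, ← hD] at h2
    have h3 : f σ ^ 2 ≤ ((w σ).length : ℝ) ^ 2 * (2 * Fintype.card (Site L) *
        Real.exp (β * (energy J h σ + V)) * D) := by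
      rw [← sq_abs]
      refine (pow_le_pow_left₀ (abs_nonneg _) h2 2).trans_eq ?_
      rw [mul_pow, Real.sq_sqrt (by positivity)]
    calc _ ≤ _ := mul_le_mul_of_nonneg_left h3 (gibbsWeight_pos σ).le
      -- The Gibbs weight of `σ` cancels its energy in the height of the path and leaves exp(βV).
      _ = 2 * ((w σ).length : ℝ) ^ 2 * Fintype.card (Site L) *
          ((Real.exp (-(β * energy J h σ)) * Real.exp (β * (energy J h σ + V))) * D) := by
        rw [gibbsWeight]; ring
      _ = _ := by
        rw [← Real.exp_add]
        ring_nf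
  rw [inv_mul_le_iff₀ (by positivity)]
  calc _ ≤ ∑ σ, 2 * ((w σ).length : ℝ) ^ 2 * Fintype.card (Site L) * (Real.exp (β * V) * D) :=
        Finset.sum_le_sum fun σ _ => h1 σ
    _ ≤ _ := by
      rw [← Finset.sum_mul, mul_assoc _ (Real.exp _) D]
      exact mul_le_mul_of_nonneg_right (by linarith) (by positivity)

end Gap

/-! ### Stable configurations -/

section Stable

variable {L : ℕ} [NeZero L] {J h : ℝ}

/-- Every configuration is connected below its energy plus `2 * J` to a constant one. -/
theorem exists_connectedBelow_constant (hL : 2 ≤ L) (hh : 0 < h) (hJ : 2 * h ≤ J)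
    (h_nonint : ∀ n : ℤ, J / (2 * h) - 1 / 2 ≠ (n : ℝ)) (σ : Config L) :
    ∃ η ∈ ({allMinus L, allPlus L} : Set (Config L)),
      ConnectedBelow J h (energy J h σ + 2 * J) σ η := by
  have wf : WellFounded fun η σ : Config L => energy J h η < energy J h σ :=
    @Finite.wellFounded_of_trans_of_irrefl _ _ _ ⟨fun _ _ _ => lt_trans⟩ ⟨fun _ => lt_irrefl _⟩
  induction σ using wf.induction with
  | _ σ ih =>
    by_cases hσ : σ ∈ ({allMinus L, allPlus L} : Set (Config L))
    · exact ⟨σ, hσ, .refl (by linarith)⟩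
    · simp only [Set.mem_insert_iff, Set.mem_singleton_iff, not_or] at hσ
      obtain ⟨η, hη, h1⟩ := escapes_of_ne hL hh hJ h_nonint hσ.1 hσ.2
      obtain ⟨ζ, hζ, h2⟩ := ih η hη
      -- Since `η` has lower energy, its ceiling is below that of `σ`.
      exact ⟨ζ, hζ, h1.trans (h2.mono (by linarith))⟩

theorem Escapes.stabLevel_le {σ : Config L} (H : Escapes J h σ) :
    stabLevel J h σ ≤ ((2 * J : ℝ) : EReal) := by
  obtain ⟨η, hη, ω, hω⟩ := H
  have h1 : commHeightSet J h {σ} (lowerConfigs J h σ) ≤ ((energy J h σ + 2 * J : ℝ) : EReal) := by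
    refine iInf₂_le_of_le σ rfl (iInf₂_le_of_le η hη (iInf_le_of_le ω ?_))
    exact iSup₂_le fun ζ hζ => EReal.coe_le_coe_iff.2 (hω ζ hζ)
  unfold stabLevel
  refine (EReal.sub_le_sub h1 le_rfl).trans_eq ?_
  rw [← EReal.coe_sub]
  congr 1
  ring

theorem stabLevel_allPlus (hJ : 0 ≤ J) (hh : 0 ≤ h) : stabLevel J h (allPlus L) = ⊤ := by
  have h1 : lowerConfigs J h (allPlus L) = ∅ :=
    Set.eq_empty_of_forall_notMem fun η hη => not_lt.2 (energy_allPlus_le hJ hh η) hη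
  simp [stabLevel, commHeightSet, h1]

theorem energy_spinFlip_allMinus (hL : 2 ≤ L) (x : Site L) :
    energy J h (spinFlip (allMinus L) x) = energy J h (allMinus L) + (3 * J - h) := by
  obtain ⟨a, b, c, N⟩ : ∃ a b c, HasNeighbors x a b c := by
    rcases x with x | x
    · exact ⟨_, _, _, hasNeighbors_inl hL x⟩
    · exact ⟨_, _, _, hasNeighbors_inr hL x⟩
  have h1 := N.energy_spinFlip (J := J) (h := h) (allMinus L)
  have h2 : ∀ y, spin (allMinus L) y = -1 := fun y => spin_eq_neg_one rfl
  rw [h2, h2, h2, h2] at h1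
  linarith

/-- Any path to lower energy must leave all-minus, and its first flip breaks three bonds. -/
theorem le_stabLevel_allMinus (hL : 2 ≤ L) :
    ((3 * J - h : ℝ) : EReal) ≤ stabLevel J h (allMinus L) := by
  have h1 : ((energy J h (allMinus L) + (3 * J - h) : ℝ) : EReal) ≤
      commHeightSet J h {allMinus L} (lowerConfigs J h (allMinus L)) := by
    refine le_iInf₂ fun σ hσ => le_iInf₂ fun η hη => le_iInf fun ω => ?_
    obtain rfl : σ = allMinus L := hσ
    cases ω with
    | nil => exact absurd hη (lt_irrefl (energy J h (allMinus L)))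
    | @cons _ ζ _ hadj ω =>
      have hadj' := hadj
      obtain ⟨x, hx⟩ := hadj'
      rw [← energy_spinFlip_allMinus hL x, hx]
      exact le_iSup₂_of_le ζ (by simp) le_rfl
  refine le_trans ?_ (EReal.sub_le_sub h1 le_rfl)
  rw [← EReal.coe_sub, EReal.coe_le_coe_iff]
  linarith

theorem stableSet_eq (hL : 2 ≤ L) (hh : 0 < h) (hJ : 2 * h ≤ J)
    (h_nonint : ∀ n : ℤ, J / (2 * h) - 1 / 2 ≠ (n : ℝ)) :
    stableSet L J h (2 * J) = {allMinus L, allPlus L} := by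
  ext σ
  simp only [stableSet, Set.mem_ofPred_eq, Set.mem_insert_iff, Set.mem_singleton_iff]
  constructor
  · intro hσ
    by_contra! hne
    exact not_lt.2 (escapes_of_ne hL hh hJ h_nonint hne.1 hne.2).stabLevel_le hσ
  · rintro (rfl | rfl)
    · exact lt_of_lt_of_le (EReal.coe_lt_coe_iff.2 (by linarith)) (le_stabLevel_allMinus hL)
    · rw [stabLevel_allPlus (by linarith) hh.le]
      exact EReal.coe_lt_top _

end Stable

/-! ### Super-exponential smallness -/

theorem isSES_of_le {f : ℝ≥0 → ℝ≥0∞} {a b : ℝ} (hb : 0 < b)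
    (hf : ∀ β : ℝ≥0, 1 ≤ β → f β ≤ ENNReal.ofReal (Real.exp (a * β - b * β ^ 2))) : IsSES f := by
  have h1 : Filter.Tendsto (fun β : ℝ≥0 => a - b * (β : ℝ)) Filter.atTop Filter.atBot := by
    refine Filter.tendsto_atBot_add_const_left _ a (Filter.tendsto_neg_atTop_atBot.comp ?_)
    exact (NNReal.tendsto_coe_atTop.2 Filter.tendsto_id).const_mul_atTop hb
  have h2 : Filter.Tendsto (fun β : ℝ≥0 => ((a - b * (β : ℝ) : ℝ) : EReal)) Filter.atTop
      (nhds ⊥) := EReal.tendsto_coe_nhds_bot_iff.2 h1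
  refine tendsto_of_tendsto_of_tendsto_of_le_of_le' tendsto_const_nhds h2
    (Filter.Eventually.of_forall fun _ => bot_le) ?_
  filter_upwards [Filter.eventually_ge_atTop 1] with β hβ
  have hβ0 : (0 : ℝ) < β := by exact_mod_cast zero_lt_one.trans_le hβ
  have h3 := ENNReal.log_monotone (hf β hβ)
  rw [ENNReal.log_ofReal_of_pos (Real.exp_pos _), Real.log_exp] at h3
  refine (EReal.div_le_div_right_of_nonneg (EReal.coe_nonneg.2 hβ0.le) h3).trans_eq ?_
  rw [← EReal.coe_div]
  congr 1
  field_simp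

variable {L : ℕ} [NeZero L] {J h : ℝ}

/-- A crude bound suffices: a factor exponential in β is negligible against exp(-cβ²). -/
theorem exists_sum_gibbsWeight_le (L : ℕ) [NeZero L] (J h : ℝ) :
    ∃ D : ℝ, 0 ≤ D ∧ ∀ (β : ℝ≥0) (σ : Config L), ∑ η : Config L, gibbsWeight J h β η ≤
      (Fintype.card (Config L) * Real.exp (β * D)) * gibbsWeight J h β σ := by
  refine ⟨2 * ∑ σ : Config L, |energy J h σ|, by positivity, fun β σ => ?_⟩
  have h1 : ∀ η : Config L, |energy J h η| ≤ ∑ σ : Config L, |energy J h σ| := fun η =>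
    Finset.single_le_sum (f := fun σ : Config L => |energy J h σ|) (fun _ _ => abs_nonneg _)
      (Finset.mem_univ η)
  rw [mul_assoc, ← nsmul_eq_mul, ← Finset.card_univ (α := Config L)]
  refine Finset.sum_le_card_nsmul _ _ _ fun η _ => ?_
  rw [gibbsWeight, gibbsWeight, ← Real.exp_add, Real.exp_le_exp]
  have h2 := h1 η
  have h3 := h1 σ
  have h4 := neg_abs_le (energy J h η)
  have h5 := le_abs_self (energy J h σ)
  have h6 : -energy J h η ≤ 2 * (∑ σ : Config L, |energy J h σ|) - energy J h σ := by linarith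
  have := mul_le_mul_of_nonneg_left h6 (NNReal.coe_nonneg β)
  rw [mul_sub] at this
  linarith [this, mul_neg (β : ℝ) (energy J h η)]

/-- If every configuration is connected to `A` below its energy plus `V`, then `A` is hit before
the time `exp (β (V + ε))` up to a super-exponentially small probability. -/
theorem isSES_hitTail {A : Set (Config L)} {V ε : ℝ} (hV : 0 ≤ V) (hε : 0 < ε)
    (hA : ∀ σ, ∃ η ∈ A, ConnectedBelow J h (energy J h σ + V) σ η) :
    IsSES fun β : ℝ≥0 => ⨆ σ, hitTail J h β σ A (Real.exp (β * (V + ε))) := by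
  obtain ⟨C, hC, hgap⟩ := exists_gap hA
  obtain ⟨D, hD, hK⟩ := exists_sum_gibbsWeight_le L J h
  set N : ℝ := (Fintype.card (Config L) : ℝ) with hN
  have hN1 : 1 ≤ N := by rw [hN]; exact_mod_cast Fintype.card_pos
  -- The squared survival has exponent at most log N + βD + 2/C - exp(βε)/C. Using exp(x) ≥ x²/2 and
  -- β ≥ 1 and halving for the square root gives `a` and `b`.
  refine isSES_of_le (a := (Real.log N + 2 / C + D) / 2) (b := ε ^ 2 / (4 * C)) (by positivity)
    fun β hβ => iSup_le fun σ => ?_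
  have hβ1 : (1 : ℝ) ≤ β := by exact_mod_cast hβ
  have hT : 1 ≤ Real.exp (β * (V + ε)) := Real.one_le_exp (by positivity)
  obtain ⟨m, hm⟩ : ∃ m, ⌊Real.exp (β * (V + ε))⌋₊ = m + 1 :=
    Nat.exists_eq_succ_of_ne_zero (Nat.floor_pos.2 hT).ne'
  refine (hitTail_le_survival J h β σ A (Nat.floor_le (Real.exp_pos _).le)).trans
    (ENNReal.ofReal_le_ofReal ?_)
  rw [hm]
  refine le_of_sq_le_sq ?_ (Real.exp_pos _).le
  have h1 := survival_succ_sq_le (transProb_nonneg J h β) (sum_transProb J h β) gibbsWeight_pos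
    gibbsWeight_mul_transProb_comm (hgap β) (hK β) m σ
  refine h1.trans ?_
  rw [← Real.exp_log (show 0 < N by linarith), ← Real.exp_add, ← Real.exp_add, sq,
    ← Real.exp_add, Real.exp_le_exp, Real.log_exp]
  -- One unit is lost to the floor and one to the extra step in `survival_succ_sq_le`.
  have h2 : Real.exp (β * (V + ε)) - 2 ≤ m := by
    have := Nat.lt_floor_add_one (Real.exp (β * (V + ε)))
    rw [hm] at this
    push_cast at this
    linarith
  have h3 : (C * Real.exp (β * V))⁻¹ * Real.exp (β * (V + ε)) = Real.exp (β * ε) / C := by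
    rw [mul_add, Real.exp_add]
    field_simp
  have h4 : (C * Real.exp (β * V))⁻¹ ≤ 1 / C := by
    rw [inv_eq_one_div]
    exact one_div_le_one_div_of_le hC
      (le_mul_of_one_le_right hC.le (Real.one_le_exp (by positivity)))
  have h5 := mul_le_mul_of_nonneg_left h2
    (show 0 ≤ (C * Real.exp (β * V))⁻¹ by positivity)
  rw [mul_sub, h3] at h5
  have h6 : (β * ε) ^ 2 / 2 / C ≤ Real.exp (β * ε) / C := by
    refine div_le_div_of_nonneg_right ?_ hC.le
    have := Real.quadratic_le_exp_of_nonneg (show 0 ≤ β * ε by positivity)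
    have : 0 ≤ β * ε := by positivity
    linarith
  have h7 : (Real.log N + 2 / C) * 1 ≤ (Real.log N + 2 / C) * β :=
    mul_le_mul_of_nonneg_left hβ1 (add_nonneg (Real.log_nonneg hN1) (by positivity))
  have h8 : ε ^ 2 / (4 * C) * (β : ℝ) ^ 2 * 2 = (β * ε) ^ 2 / 2 / C := by
    field_simp
    ring
  have h9 : 2 / C = 2 * (1 / C) := by ring
  linarith

end HexIsing

theorem proposition1 (L : ℕ) [NeZero L] (J h : ℝ) (h_pos : 0 < h) (h_lt_one : h < 1)
    (hJ : 2 * h ≤ J) (h_nonint : ∀ n : ℤ, J / (2 * h) - 1 / 2 ≠ (n : ℝ))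
    (h_torus : (4 * J / h) ^ 2 ≤ (Fintype.card (HexIsing.Site L) : ℝ)) :
    HexIsing.stableSet L J h (2 * J) = {HexIsing.allMinus L, HexIsing.allPlus L} ∧
      ∀ ε : ℝ, 0 < ε →
        HexIsing.IsSES fun β : ℝ≥0 => ⨆ σ : HexIsing.Config L,
          HexIsing.hitTail J h β σ (HexIsing.stableSet L J h (2 * J))
            (Real.exp (β * (2 * J + ε))) := by
  -- For `L = 1` there are two sites, while 4J/h ≥ 8 forces at least 64.
  have hL : 2 ≤ L := by
    by_contra hL
    obtain rfl : L = 1 := by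
      have := NeZero.ne L
      omega
    have h1 : 8 ≤ 4 * J / h := by
      rw [le_div_iff₀ h_pos]
      linarith
    have h2 : (Fintype.card (HexIsing.Site 1) : ℝ) = 2 := by
      simp [HexIsing.Site]
    nlinarith
  have h1 := HexIsing.stableSet_eq hL h_pos hJ h_nonint
  refine ⟨h1, fun ε hε => ?_⟩
  rw [h1]
  exact HexIsing.isSES_hitTail (by linarith) hε
    (HexIsing.exists_connectedBelow_constant hL h_pos hJ h_nonint)
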